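/- Let $\ell>0$ and let $\Omega\subset\mathbb R^2$ be an (open) equilateral triangle with sides of length $\ell$. A Dirichlet eigenvalue of $\Omega$ is a real number $\lambda$ for which there is $u\not\equiv 0$ in $H^2(\Omega)$ with $\Delta u+\lambda u=0$ in $\Omega$ and $u=0$ on $\partial\Omega$, where $\Delta=\partial_x^2+\partial_y^2$; its multiplicity is the dimension of the space of such functions $u$. (Such $u$ are twice continuously differentiable in $\Omega$ and continuous up to the boundary, and are read so.) The eigenvalues are positive and have finite multiplicities. Let $$\zeta_\nabla(s)=\sum_{\lambda}\lambda^{-s}\qquad(\operatorname{Re}s>1)$$ be the spectral zeta function, the sum being over the Dirichlet eigenvalues repeated according to multiplicity, and let $$G_\nabla(s)=\sum_{(m,k)\in\mathbb Z^2\setminus\{(0,0)\}}\frac1{\pi^{2s}|m+kz|^{2s}}\quad(\operatorname{Re}s>1),\qquad z=\frac{-3+i\sqrt3}{2}.$$ Both series converge absolutely for $\operatorname{Re} s>1$. Let $\zeta_R$ be the Riemann zeta function. Then, for $\operatorname{Re}s>1$, $$\zeta_\nabla(s)=\frac16\left(\frac{3\ell}{4\pi}\right)^{2s}\Bigg[-4\zeta_R(2s)+\frac{2^{2s}\sqrt\pi\,\zeta_R(2s-1)\Gamma(s-\frac12)}{\Gamma(s)\,3^{s-1/2}}+\frac{4\pi^s2^{s-1/2}}{\Gamma(s)\,3^{s/2-1/4}}\sum_{n=1}^\infty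 b_n(s)\Bigg],$$ $$b_n(s)=n^{s-1/2}\sum_{d\mid n}d^{1-2s}(-1)^n\int_0^\infty x^{s-3/2}e^{-\pi n\sqrt3(x+x^{-1})/2}\,dx,$$ and equivalently $$\zeta_\nabla(s)=\frac16\left(\frac{3\ell}{4}\right)^{2s}\left[G_\nabla(s)-\frac{6}{\pi^{2s}}\zeta_R(2s)\right].$$ For every $s\in\mathbb C$ the integrals in $b_n(s)$ and the series $\sum_n b_n(s)$ converge absolutely, and $b_n(s)=O(e^{-cn})$ as $n\to\infty$ for every $c<\pi\sqrt3$. Moreover $\zeta_\nabla$ and $G_\nabla$ extend meromorphically to $\mathbb C$, the first analytic outside $\{1,\frac12\}$ and the second analytic outside $\{1\}$; with these extensions the first formula holds for all $s$ other than $1$ and $\frac12,-\frac12,-\frac32,\dots$ (with $1/\Gamma(s)=0$ at $s=0,-1,-2,\dots$), and the second for all $s\notin\{1,\frac12\}$. -/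

import Mathlib

open Real Set MeasureTheory TopologicalSpace Asymptotics Filter
open scoped Laplacian

/-- The Euclidean plane. -/
abbrev Plane : Type := EuclideanSpace ℝ (Fin 2)

/-- The open equilateral triangle with vertices `(0, 0)`, `(ℓ, 0)` and `(ℓ / 2, √3 ℓ / 2)`. -/
def standardTriangle (ℓ : ℝ) : Set Plane :=
  {p | 0 < p 1 ∧ p 1 < √3 * p 0 ∧ p 1 < √3 * (ℓ - p 0)}

/-- `Ω` is (the interior of) an equilateral triangle of side `ℓ`, in any position in the plane. -/
def IsEquilateralTriangle (ℓ : ℝ) (Ω : Opens Plane) : Prop :=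
  ∃ e : Plane ≃ᵃⁱ[ℝ] Plane, (Ω : Set Plane) = e '' standardTriangle ℓ

/-- `u` solves the Dirichlet problem `Δ u + μ u = 0` in `Ω`, `u = 0` on `∂Ω`.

A function on the closure of `Ω` that vanishes on the boundary is represented by its extension
by zero to the whole plane; the extension is continuous exactly when the function is continuous
up to the boundary with boundary value `0`.  The function is twice continuously differentiable
in `Ω` and belongs to the Sobolev space `H²(Ω)`: it and its first and second derivatives are
square integrable over `Ω`. -/
structure IsDirichletSolution (Ω : Opens Plane) (μ : ℝ) (u : Plane → ℂ) : Prop where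
  continuous : Continuous u
  eq_zero : ∀ p, p ∉ Ω → u p = 0
  contDiffAt : ∀ p ∈ Ω, ContDiffAt ℝ 2 u p
  memLp : ∀ k : ℕ, k ≤ 2 → MemLp (iteratedFDeriv ℝ k u) 2 (volume.restrict (Ω : Set Plane))
  equation : ∀ p ∈ Ω, Δ u p + (μ : ℂ) * u p = 0

theorem IsDirichletSolution.zero (Ω : Opens Plane) (μ : ℝ) : IsDirichletSolution Ω μ 0 where
  continuous := continuous_const
  eq_zero _ _ := rfl
  contDiffAt _ _ := contDiffAt_const
  memLp k _ := by
    have h : iteratedFDeriv ℝ k (0 : Plane → ℂ) = 0 := iteratedFDeriv_fun_zero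
    rw [h]
    exact MemLp.zero
  equation p _ := by
    have h : Δ (0 : Plane → ℂ) p = 0 :=
      congrFun (InnerProductSpace.laplacian_const (E := Plane) (c := (0 : ℂ))) p
    simp [h]

theorem IsDirichletSolution.add {Ω : Opens Plane} {μ : ℝ} {u v : Plane → ℂ}
    (hu : IsDirichletSolution Ω μ u) (hv : IsDirichletSolution Ω μ v) :
    IsDirichletSolution Ω μ (u + v) where
  continuous := hu.continuous.add hv.continuous
  eq_zero p hp := by simp [hu.eq_zero p hp, hv.eq_zero p hp]
  contDiffAt p hp := (hu.contDiffAt p hp).add (hv.contDiffAt p hp)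
  memLp k hk := by
    refine ((hu.memLp k hk).add (hv.memLp k hk)).ae_eq
      (ae_restrict_of_forall_mem Ω.isOpen.measurableSet fun p hp => ?_)
    have hk' : (k : WithTop ℕ∞) ≤ 2 := by exact_mod_cast hk
    exact (iteratedFDeriv_add_apply ((hu.contDiffAt p hp).of_le hk')
      ((hv.contDiffAt p hp).of_le hk')).symm
  equation p hp := by
    rw [(hu.contDiffAt p hp).laplacian_add (hv.contDiffAt p hp), Pi.add_apply]
    linear_combination hu.equation p hp + hv.equation p hp

theorem IsDirichletSolution.smul {Ω : Opens Plane} {μ : ℝ} {u : Plane → ℂ} (c : ℂ)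
    (hu : IsDirichletSolution Ω μ u) : IsDirichletSolution Ω μ (c • u) where
  continuous := hu.continuous.const_smul c
  eq_zero p hp := by simp [hu.eq_zero p hp]
  contDiffAt p hp := (hu.contDiffAt p hp).const_smul c
  memLp k hk := by
    refine ((hu.memLp k hk).const_smul c).ae_eq
      (ae_restrict_of_forall_mem Ω.isOpen.measurableSet fun p hp => ?_)
    have hk' : (k : WithTop ℕ∞) ≤ 2 := by exact_mod_cast hk
    exact (iteratedFDeriv_const_smul_apply ((hu.contDiffAt p hp).of_le hk')).symm
  equation p hp := by
    rw [InnerProductSpace.laplacian_smul c (hu.contDiffAt p hp), Pi.smul_apply, smul_eq_mul,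
      smul_eq_mul]
    linear_combination c * hu.equation p hp

/-- The space of all solutions of the Dirichlet problem with parameter `μ`. -/
def dirichletEigenspace (Ω : Opens Plane) (μ : ℝ) : Submodule ℂ (Plane → ℂ) where
  carrier := {u | IsDirichletSolution Ω μ u}
  zero_mem' := IsDirichletSolution.zero Ω μ
  add_mem' hu hv := hu.add hv
  smul_mem' c _ hu := hu.smul c

/-- The Dirichlet eigenvalues of `Ω`, as a set. -/
def dirichletSpectrum (Ω : Opens Plane) : Set ℝ := {μ | dirichletEigenspace Ω μ ≠ ⊥}

/-- The contribution of the eigenvalue `μ`, counted with multiplicity, to the zeta function. -/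
noncomputable def dirichletZetaTerm (Ω : Opens Plane) (s : ℂ) (μ : dirichletSpectrum Ω) : ℂ :=
  (Module.finrank ℂ (dirichletEigenspace Ω μ) : ℂ) * ((μ : ℝ) : ℂ) ^ (-s)

/-- The Dirichlet series of the spectral zeta function: the sum of `μ ^ (-s)` over the Dirichlet
eigenvalues, each repeated according to its multiplicity. -/
noncomputable def dirichletZeta (Ω : Opens Plane) (s : ℂ) : ℂ :=
  ∑' μ : dirichletSpectrum Ω, dirichletZetaTerm Ω s μ

/-- The point `z = (-3 + i √3) / 2`. -/
noncomputable def zTri : ℂ := (-3 + Complex.I * (√3 : ℝ)) / 2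

/-- The terms of the Epstein series, indexed by the pairs `(m, k) ≠ (0, 0)` of integers. -/
noncomputable def epsteinTerm (s : ℂ) (p : {p : ℤ × ℤ // p ≠ 0}) : ℂ :=
  1 / ((π : ℂ) ^ (2 * s) * ((‖(p.1.1 : ℂ) + (p.1.2 : ℂ) * zTri‖ : ℝ) : ℂ) ^ (2 * s))

/-- The series of the Epstein zeta function `G_∇`. -/
noncomputable def epsteinTri (s : ℂ) : ℂ := ∑' p : {p : ℤ × ℤ // p ≠ 0}, epsteinTerm s p

/-- The integrand of the Bessel-type integral. -/
noncomputable def besselIntegrand (s : ℂ) (n : ℕ) (x : ℝ) : ℂ :=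
  (x : ℂ) ^ (s - 3 / 2) * (Real.exp (-π * n * √3 * (x + x⁻¹) / 2) : ℂ)

/-- The `n`-th term of the series of divisor sums and Bessel-type integrals. -/
noncomputable def besselTerm (s : ℂ) (n : ℕ) : ℂ :=
  (n : ℂ) ^ (s - 1 / 2) * (∑ d ∈ n.divisors, (d : ℂ) ^ (1 - 2 * s) * (-1) ^ n) *
    ∫ x in Ioi (0 : ℝ), besselIntegrand s n x

/-- The Chowla-Selberg type expression. -/
noncomputable def chowlaSelbergTri (ℓ : ℝ) (s : ℂ) : ℂ :=
  1 / 6 * ((3 * ℓ / (4 * π) : ℝ) : ℂ) ^ (2 * s) *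
    (-4 * riemannZeta (2 * s)
      + 2 ^ (2 * s) * (√π : ℝ) * riemannZeta (2 * s - 1) * Complex.Gamma (s - 1 / 2)
          / (Complex.Gamma s * 3 ^ (s - 1 / 2))
      + 4 * (π : ℂ) ^ s * 2 ^ (s - 1 / 2) / (Complex.Gamma s * 3 ^ (s / 2 - 1 / 4))
          * ∑' n : ℕ+, besselTerm s n)

/-- The expression in terms of a value `g` of the Epstein zeta function at `s`. -/
noncomputable def epsteinExpression (ℓ : ℝ) (s g : ℂ) : ℂ :=
  1 / 6 * ((3 * ℓ / 4 : ℝ) : ℂ) ^ (2 * s) *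
    (g - 6 / (π : ℂ) ^ (2 * s) * riemannZeta (2 * s))

/-- `F` is the meromorphic continuation to the whole complex plane of the function `f`, given on
the half-plane `Re s > 1`, and `F` has no poles outside `P`. -/
def IsMeromorphicContinuation (f F : ℂ → ℂ) (P : Set ℂ) : Prop :=
  (∀ s : ℂ, 1 < s.re → F s = f s) ∧ Meromorphic F ∧ AnalyticOnNhd ℂ F Pᶜ

/-! The spectrum comes from Lamé's trigonometric eigenfunctions. In affine coordinates `(s, t)`
adapted to the triangle, its sides lie on `t = 2 s`, `s = 2 t`, `s + t = 1`; it is a fundamental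
domain of the affine Weyl group of type A₂, whose translations are `ℤ²`. Antisymmetrising the
character with frequency `(m, n)` over the finite Weyl group gives a function that vanishes on all
three sides and has eigenvalue `16 π² (m² + m n + n²) / (9 ℓ²)`.

These functions account for the whole eigenspace. By Green's formula a solution for `μ` is
orthogonal to every Lamé function with another eigenvalue
(`IsTriangleChart.integral_mul_lame_eq_zero`). If a continuous `u`, extended by zero, is orthogonal
to all of them, then the antisymmetrisation of `u` has vanishing Fourier transform on `ℤ²`, so its
periodisation vanishes by Poisson summation; on the triangle that periodisation is `u` itself
(`IsTriangleChart.eq_zero_of_integral_mul_lame`). Together with linear independence, the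
multiplicity of `μ` is the number of pairs `m, n ≥ 1` with that eigenvalue
(`IsTriangleChart.finrank_eq`).

So the zeta function is a sum of `(m² + m n + n²) ^ (-s)` over an open sector of the hexagonal
lattice. Six rotated sectors and six rays tile the nonzero lattice points, and the rays contribute
`6 ζ(2 s)`; this is the formula with `G_∇`, since `ℤ + ℤ z` is the same lattice
(`tsum_one_div_qTri_eq_sector`).

The Chowla-Selberg formula follows by fixing `k ≠ 0` and applying the theta functional equation to
the sum over `m` (`mellin_evenKernel`). The zero frequency yields `ζ(2 s - 1)`; a frequency `n`
yields a Bessel integral depending only on `n k`, and grouping by this product produces the divisor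
sums (`tsum_besselTerm`). The Bessel series is entire in `s`, so the continuation reduces to the
poles of completed zeta functions, and in `G_∇` only the one at `1` survives
(`epsteinRegular_add_epsteinPolar`). -/

/-! ### Bessel-type integrals: convergence, uniform bounds, holomorphy. -/

theorem isBigO_exp_neg_mul_add_inv_atTop {c : ℝ} (hc : 0 < c) (a : ℝ) :
    (fun x : ℝ => (rexp (-c * (x + x⁻¹)) : ℂ)) =O[atTop] (· ^ (-a) : ℝ → ℝ) := by
  refine IsBigO.trans ?_ (isLittleO_exp_neg_mul_rpow_atTop hc (-a)).isBigO
  refine IsBigO.of_bound 1 ?_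
  filter_upwards [eventually_gt_atTop 0] with x hx
  rw [Complex.norm_real, one_mul, norm_of_nonneg (exp_pos _).le, norm_of_nonneg (exp_pos _).le]
  apply exp_le_exp.mpr
  have : 0 < c * x⁻¹ := by positivity
  linarith

/-- The kernel is invariant under `x ↦ x⁻¹`, so its decay at infinity transfers to `0`. -/
theorem isBigO_exp_neg_mul_add_inv_nhdsGT {c : ℝ} (hc : 0 < c) (b : ℝ) :
    (fun x : ℝ => (rexp (-c * (x + x⁻¹)) : ℂ)) =O[nhdsWithin 0 (Ioi 0)] (· ^ (-b) : ℝ → ℝ) := by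
  have h := (isBigO_exp_neg_mul_add_inv_atTop hc (-b)).comp_tendsto
    (tendsto_inv_nhdsGT_zero (𝕜 := ℝ))
  refine (h.congr' ?_ ?_)
  · filter_upwards with x
    simp [add_comm]
  · filter_upwards [self_mem_nhdsWithin] with x hx
    simp [inv_rpow (le_of_lt (mem_Ioi.mp hx)), rpow_neg (le_of_lt (mem_Ioi.mp hx))]

theorem locallyIntegrableOn_exp_neg_mul_add_inv (c : ℝ) :
    LocallyIntegrableOn (fun x : ℝ => (rexp (-c * (x + x⁻¹)) : ℂ)) (Ioi 0) := by
  refine ContinuousOn.locallyIntegrableOn ?_ measurableSet_Ioi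
  have : ContinuousOn (fun x : ℝ => x⁻¹) (Ioi 0) := continuousOn_inv₀.mono fun x hx => ne_of_gt hx
  fun_prop

theorem mellinConvergent_exp_neg_mul_add_inv {c : ℝ} (hc : 0 < c) (s : ℂ) :
    MellinConvergent (fun x : ℝ => (rexp (-c * (x + x⁻¹)) : ℂ)) s :=
  mellinConvergent_of_isBigO_rpow (locallyIntegrableOn_exp_neg_mul_add_inv c)
    (isBigO_exp_neg_mul_add_inv_atTop hc (s.re + 1)) (by linarith)
    (isBigO_exp_neg_mul_add_inv_nhdsGT hc (s.re - 1)) (by linarith)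

theorem differentiable_mellin_exp_neg_mul_add_inv {c : ℝ} (hc : 0 < c) :
    Differentiable ℂ (mellin (fun x : ℝ => (rexp (-c * (x + x⁻¹)) : ℂ))) := fun s =>
  mellin_differentiableAt_of_isBigO_rpow (locallyIntegrableOn_exp_neg_mul_add_inv c)
    (isBigO_exp_neg_mul_add_inv_atTop hc (s.re + 1)) (by linarith)
    (isBigO_exp_neg_mul_add_inv_nhdsGT hc (s.re - 1)) (by linarith)

theorem besselIntegrand_eq (s : ℂ) (n : ℕ) (x : ℝ) :
    besselIntegrand s n x =
      (x : ℂ) ^ ((s - 1 / 2) - 1) • (rexp (-(π * n * √3 / 2) * (x + x⁻¹)) : ℂ) := by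
  rw [besselIntegrand, smul_eq_mul, show s - 1 / 2 - 1 = s - 3 / 2 by ring]
  congr 3
  ring

theorem besselIntegrand_integrableOn (s : ℂ) {n : ℕ} (hn : 0 < n) :
    IntegrableOn (besselIntegrand s n) (Ioi 0) := by
  have h := mellinConvergent_exp_neg_mul_add_inv (c := π * n * √3 / 2) (by positivity) (s - 1 / 2)
  rw [MellinConvergent] at h
  exact h.congr_fun (fun x _ => (besselIntegrand_eq s n x).symm) measurableSet_Ioi

theorem integral_besselIntegrand (s : ℂ) (n : ℕ) :
    ∫ x in Ioi (0 : ℝ), besselIntegrand s n x =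
      mellin (fun x : ℝ => (rexp (-(π * n * √3 / 2) * (x + x⁻¹)) : ℂ)) (s - 1 / 2) := by
  simp_rw [besselIntegrand_eq, mellin]

theorem norm_besselIntegrand (s : ℂ) (n : ℕ) {x : ℝ} (hx : 0 < x) :
    ‖besselIntegrand s n x‖ = x ^ (s.re - 3 / 2) * rexp (-π * n * √3 * (x + x⁻¹) / 2) := by
  rw [besselIntegrand, norm_mul, Complex.norm_real, norm_of_nonneg (exp_pos _).le,
    Complex.norm_cpow_eq_rpow_re_of_pos hx]
  norm_num

/-- Since `x + x⁻¹ ≥ 2`, passing from index `1` to `n` costs a factor at most `exp (-π √3 (n - 1))`.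
The power of `x` is dominated by the sum of the powers for `Re s = R` and `Re s = -R`, one serving
`x ≥ 1` and the other `x ≤ 1`; the constant is therefore uniform in the strip. -/
theorem exists_norm_integral_besselIntegrand_le (R : ℕ) :
    ∃ C : ℝ, 0 ≤ C ∧ ∀ s : ℂ, |s.re| ≤ R → ∀ n : ℕ, 0 < n →
      ∫ x in Ioi (0 : ℝ), ‖besselIntegrand s n x‖ ≤ C * rexp (-(π * √3) * (n - 1)) := by
  refine ⟨(∫ x in Ioi (0 : ℝ), ‖besselIntegrand (R : ℂ) 1 x‖) +
    ∫ x in Ioi (0 : ℝ), ‖besselIntegrand (-(R : ℂ)) 1 x‖, by positivity, fun s hs n hn => ?_⟩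
  have h1 := (besselIntegrand_integrableOn (R : ℂ) one_pos).norm
  have h2 := (besselIntegrand_integrableOn (-(R : ℂ)) one_pos).norm
  rw [← integral_add h1 h2, ← integral_mul_const]
  refine setIntegral_mono_on (besselIntegrand_integrableOn s hn).norm
    ((h1.add h2).mul_const _) measurableSet_Ioi fun x hx => ?_
  have hx : 0 < x := hx
  rw [norm_besselIntegrand _ _ hx, norm_besselIntegrand _ _ hx, norm_besselIntegrand _ _ hx,
    ← add_mul, mul_assoc (_ + _), ← exp_add]
  have hn1 : (1 : ℝ) ≤ n := by exact_mod_cast hn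
  have hxx : 2 ≤ x + x⁻¹ := by
    have : x + x⁻¹ - 2 = (x - 1) ^ 2 / x := by field_simp; ring
    have : 0 ≤ (x - 1) ^ 2 / x := by positivity
    linarith
  have hs' := abs_le.mp hs
  gcongr
  · rcases le_total 1 x with h | h
    · have := rpow_le_rpow_of_exponent_le h (show s.re - 3 / 2 ≤ (R : ℂ).re - 3 / 2 by simp [hs'.2])
      have : 0 < x ^ ((-(R : ℂ)).re - 3 / 2) := by positivity
      linarith
    · have := rpow_le_rpow_of_exponent_ge hx h
        (show (-(R : ℂ)).re - 3 / 2 ≤ s.re - 3 / 2 by simp [hs'.1])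
      have : 0 < x ^ ((R : ℂ).re - 3 / 2) := by positivity
      linarith
  · have h3 : 0 < π * √3 := by positivity
    have h4 : 0 ≤ (π * √3) * ((n - 1) * (x + x⁻¹ - 2)) :=
      mul_nonneg h3.le (mul_nonneg (by linarith) (by linarith))
    push_cast
    nlinarith

theorem norm_divisorSum_le (R : ℕ) (s : ℂ) (hs : |s.re| ≤ R) (n : ℕ) (hn : 0 < n) :
    ‖(n : ℂ) ^ (s - 1 / 2) * (∑ d ∈ n.divisors, (d : ℂ) ^ (1 - 2 * s) * (-1) ^ n)‖ ≤
      (n : ℝ) ^ (3 * R + 2) := by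
  have hs' := abs_le.mp hs
  have hn1 : (1 : ℝ) ≤ n := by exact_mod_cast hn
  have h1 : ‖(n : ℂ) ^ (s - 1 / 2)‖ ≤ (n : ℝ) ^ R := by
    rw [Complex.norm_natCast_cpow_of_pos hn, ← rpow_natCast]
    refine rpow_le_rpow_of_exponent_le hn1 ?_
    norm_num
    linarith
  have h2 : ‖∑ d ∈ n.divisors, (d : ℂ) ^ (1 - 2 * s) * (-1) ^ n‖ ≤ n * (n : ℝ) ^ (1 + 2 * R) := by
    refine (norm_sum_le_of_le (n := fun _ => (n : ℝ) ^ (1 + 2 * R)) _ fun d hd => ?_).trans ?_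
    · have hd0 := Nat.pos_of_mem_divisors hd
      have hd1 : (1 : ℝ) ≤ d := by exact_mod_cast hd0
      have hdn : (d : ℝ) ≤ n := by exact_mod_cast Nat.divisor_le hd
      rw [norm_mul, norm_pow, norm_neg, norm_one, one_pow, mul_one,
        Complex.norm_natCast_cpow_of_pos hd0]
      refine (rpow_le_rpow_of_exponent_le hd1
        (show (1 - 2 * s).re ≤ ((1 + 2 * R : ℕ) : ℝ) by norm_num; linarith)).trans ?_
      rw [rpow_natCast]
      gcongr
    · rw [Finset.sum_const, nsmul_eq_mul]
      gcongr
      exact Nat.card_divisors_le_self n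
  rw [norm_mul]
  calc _ ≤ (n : ℝ) ^ R * (n * (n : ℝ) ^ (1 + 2 * R)) := by gcongr
    _ = _ := by ring

theorem exists_norm_besselTerm_le (R : ℕ) :
    ∃ C : ℝ, 0 ≤ C ∧ ∀ s : ℂ, |s.re| ≤ R → ∀ n : ℕ, 0 < n →
      ‖besselTerm s n‖ ≤ C * ((n : ℝ) ^ (3 * R + 2) * rexp (-(π * √3) * n)) := by
  obtain ⟨C, hC, h⟩ := exists_norm_integral_besselIntegrand_le R
  refine ⟨C * rexp (π * √3), by positivity, fun s hs n hn => ?_⟩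
  rw [besselTerm, norm_mul]
  calc _ ≤ (n : ℝ) ^ (3 * R + 2) * (C * rexp (-(π * √3) * (n - 1))) := by
        gcongr
        · exact norm_divisorSum_le R s hs n hn
        · exact (norm_integral_le_integral_norm _).trans (h s hs n hn)
    _ = _ := by
        rw [show -(π * √3) * ((n : ℝ) - 1) = π * √3 + -(π * √3) * n by ring, exp_add]
        ring

theorem exists_nat_abs_re_le (s : ℂ) : ∃ R : ℕ, |s.re| ≤ R := exists_nat_ge _

theorem summable_besselTerm (s : ℂ) : Summable fun n : ℕ+ => besselTerm s n := by
  obtain ⟨R, hR⟩ := exists_nat_abs_re_le s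
  obtain ⟨C, -, h⟩ := exists_norm_besselTerm_le R
  have h3 : 0 < π * √3 := by positivity
  have hs := (summable_pow_mul_exp_neg_nat_mul (3 * R + 2) h3).mul_left C
  exact Summable.of_norm_bounded (hs.comp_injective PNat.coe_injective) fun n => h s hR n n.pos

theorem isBigO_besselTerm (s : ℂ) {c : ℝ} (hc : c < π * √3) :
    (fun n : ℕ => besselTerm s n) =O[atTop] fun n : ℕ => rexp (-c * n) := by
  obtain ⟨R, hR⟩ := exists_nat_abs_re_le s
  obtain ⟨C, hC, h⟩ := exists_norm_besselTerm_le R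
  have h1 : (fun n : ℕ => besselTerm s n) =O[atTop]
      fun n : ℕ => (n : ℝ) ^ (3 * R + 2) * rexp (-(π * √3) * n) := by
    refine IsBigO.of_bound C ?_
    filter_upwards [eventually_gt_atTop 0] with n hn
    rw [norm_of_nonneg (by positivity)]
    exact h s hR n hn
  refine h1.trans ?_
  have hc' : 0 < π * √3 - c := by linarith
  have h2 := ((isLittleO_pow_exp_pos_mul_atTop (3 * R + 2) hc').isBigO.comp_tendsto
    tendsto_natCast_atTop_atTop).mul
      (isBigO_refl (fun n : ℕ => rexp (-(π * √3) * n)) atTop)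
  refine h2.congr (fun n => rfl) fun n => ?_
  rw [Function.comp_apply, ← exp_add]
  congr 1
  ring

theorem differentiable_besselTerm {n : ℕ} (hn : 0 < n) :
    Differentiable ℂ fun s => besselTerm s n := by
  simp_rw [besselTerm, integral_besselIntegrand]
  have hn' : (n : ℂ) ≠ 0 := by exact_mod_cast hn.ne'
  refine Differentiable.mul (Differentiable.mul ?_ ?_) ?_
  · exact Differentiable.const_cpow (by fun_prop) (Or.inl hn')
  · refine Differentiable.fun_sum fun d hd => ?_
    have hd' : (d : ℂ) ≠ 0 := by exact_mod_cast (Nat.pos_of_mem_divisors hd).ne'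
    exact (Differentiable.const_cpow (by fun_prop) (Or.inl hd')).mul_const _
  · exact (differentiable_mellin_exp_neg_mul_add_inv
      (c := π * n * √3 / 2) (by positivity)).comp (by fun_prop)

/-- The bound is uniform on each strip `|Re s| < R`, so the series converges there uniformly; the
strips exhaust the plane. -/
theorem differentiable_tsum_besselTerm : Differentiable ℂ fun s => ∑' n : ℕ+, besselTerm s n := by
  intro s
  obtain ⟨R, hR⟩ := exists_nat_gt |s.re|
  obtain ⟨C, -, h⟩ := exists_norm_besselTerm_le R
  have h3 : 0 < π * √3 := by positivity
  have hs := ((summable_pow_mul_exp_neg_nat_mul (3 * R + 2) h3).mul_left C).comp_injective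
    PNat.coe_injective
  have ho : IsOpen {w : ℂ | |w.re| < R} :=
    isOpen_lt (by fun_prop) continuous_const
  exact (Complex.differentiableOn_tsum_of_summable_norm hs
    (fun n => (differentiable_besselTerm n.pos).differentiableOn) ho
    (fun n w hw => h w (le_of_lt hw) n n.pos)).differentiableAt (ho.mem_nhds hR)

/-! ### The Epstein series: absolute convergence and splitting into rows. -/

/-- The quadratic form `|m + k z| ^ 2`. -/
noncomputable def qTri (p : ℤ × ℤ) : ℝ := (p.1 : ℝ) ^ 2 - 3 * p.1 * p.2 + 3 * (p.2 : ℝ) ^ 2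

theorem norm_sq_add_mul_zTri (m k : ℤ) : ‖(m : ℂ) + (k : ℂ) * zTri‖ ^ 2 = qTri (m, k) := by
  have h3 : √3 * √3 = 3 := mul_self_sqrt (by norm_num)
  rw [← Complex.normSq_eq_norm_sq, Complex.normSq_apply]
  simp [zTri, qTri]
  linear_combination (k : ℝ) ^ 2 / 4 * h3

/-- Completing the square in either variable gives `m² / 4 + 3 (k - m / 2)²` and `(m - 3 k / 2)² + 3
k² / 4`. Comparison with the sup norm makes the Eisenstein series bounds available. -/
theorem sq_norm_le_qTri (p : ℤ × ℤ) : ‖![p.1, p.2]‖ ^ 2 / 4 ≤ qTri p := by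
  rw [EisensteinSeries.norm_eq_max_natAbs]
  simp only [Matrix.cons_val_zero, Matrix.cons_val_one, Matrix.cons_val_fin_one, qTri]
  rcases max_cases p.1.natAbs p.2.natAbs with ⟨h, -⟩ | ⟨h, -⟩ <;> rw [h] <;>
    rw [Nat.cast_natAbs, Int.cast_abs, sq_abs]
  · nlinarith [sq_nonneg ((p.2 : ℝ) - p.1 / 2)]
  · nlinarith [sq_nonneg ((p.1 : ℝ) - 3 / 2 * p.2)]

theorem qTri_pos {p : ℤ × ℤ} (hp : p ≠ 0) : 0 < qTri p := by
  refine lt_of_lt_of_le ?_ (sq_norm_le_qTri p)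
  have : ![p.1, p.2] ≠ 0 := fun h => hp (Prod.ext (congrFun h 0) (congrFun h 1))
  positivity

theorem qTri_zero : qTri 0 = 0 := by simp [qTri]

theorem qTri_nonneg (p : ℤ × ℤ) : 0 ≤ qTri p := le_trans (by positivity) (sq_norm_le_qTri p)

theorem ne_zero_of_one_lt_re {s : ℂ} (hs : 1 < s.re) : s ≠ 0 := by
  rintro rfl
  norm_num at hs

theorem norm_one_div_qTri_cpow {s : ℂ} (hs : 1 < s.re) (p : ℤ × ℤ) :
    ‖1 / (qTri p : ℂ) ^ s‖ = qTri p ^ (-s.re) := by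
  rw [norm_div, norm_one, rpow_neg (qTri_nonneg p),
    Complex.norm_cpow_eq_rpow_re_of_nonneg (qTri_nonneg p) (by linarith), one_div]

theorem summable_one_div_qTri_cpow {s : ℂ} (hs : 1 < s.re) :
    Summable fun p : ℤ × ℤ => 1 / (qTri p : ℂ) ^ s := by
  have h := ((EisensteinSeries.summable_one_div_norm_rpow (k := 2 * s.re) (by linarith)).comp_injective
    (finTwoArrowEquiv ℤ).symm.injective).mul_left (4 ^ s.re)
  refine Summable.of_norm_bounded h fun p => ?_
  rw [norm_one_div_qTri_cpow hs]
  simp only [Function.comp_apply, finTwoArrowEquiv_symm_apply]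
  rcases eq_or_ne p 0 with rfl | hp
  · rw [qTri_zero, zero_rpow (by linarith)]
    positivity
  have hn : 0 < ‖![p.1, p.2]‖ :=
    norm_pos_iff.mpr fun h => hp (Prod.ext (congrFun h 0) (congrFun h 1))
  calc qTri p ^ (-s.re) ≤ (‖![p.1, p.2]‖ ^ 2 / 4) ^ (-s.re) :=
        rpow_le_rpow_of_nonpos (by positivity) (sq_norm_le_qTri p) (by linarith)
    _ = _ := by
        rw [div_rpow (by positivity) (by norm_num), ← rpow_natCast, ← rpow_mul hn.le,
          rpow_neg (by norm_num : (0 : ℝ) ≤ 4), div_inv_eq_mul, mul_comm]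
        congr 2
        push_cast
        ring

theorem cpow_two_mul_eq {x : ℝ} (hx : 0 ≤ x) (s : ℂ) : (x : ℂ) ^ (2 * s) = ((x ^ 2 : ℝ) : ℂ) ^ s := by
  rcases hx.eq_or_lt with rfl | hx
  · rcases eq_or_ne s 0 with rfl | hs
    · simp
    · simp [Complex.zero_cpow hs, Complex.zero_cpow (mul_ne_zero two_ne_zero hs)]
  · rw [two_mul, Complex.cpow_add _ _ (by exact_mod_cast hx.ne'), pow_two, Complex.ofReal_mul,
      Complex.mul_cpow_ofReal_nonneg hx.le hx.le]

theorem epsteinTerm_eq (s : ℂ) (p : {p : ℤ × ℤ // p ≠ 0}) :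
    epsteinTerm s p = 1 / (π : ℂ) ^ (2 * s) * (1 / (qTri p : ℂ) ^ s) := by
  rw [epsteinTerm, cpow_two_mul_eq (norm_nonneg _), norm_sq_add_mul_zTri]
  exact (one_div_mul_one_div _ _).symm

theorem summable_epsteinTerm {s : ℂ} (hs : 1 < s.re) : Summable (epsteinTerm s) := by
  simp_rw [funext (epsteinTerm_eq s)]
  exact ((summable_one_div_qTri_cpow hs).comp_injective Subtype.val_injective).mul_left _

/-- The origin may be included: with `s ≠ 0` its term is `1 / 0 = 0`. -/
theorem epsteinTri_eq {s : ℂ} (hs : 1 < s.re) :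
    epsteinTri s = 1 / (π : ℂ) ^ (2 * s) * ∑' p : ℤ × ℤ, 1 / (qTri p : ℂ) ^ s := by
  rw [epsteinTri, tsum_congr (epsteinTerm_eq s), tsum_mul_left]
  congr 1
  refine tsum_subtype_eq_of_support_subset (f := fun p => 1 / (qTri p : ℂ) ^ s)
    (s := {p : ℤ × ℤ | p ≠ 0}) ?_
  intro p hp h
  subst h
  simp [qTri_zero, Complex.zero_cpow (ne_zero_of_one_lt_re hs)] at hp

theorem riemannZeta_eq_tsum_pnat {s : ℂ} (hs : 1 < s.re) :
    riemannZeta s = ∑' n : ℕ+, 1 / (n : ℂ) ^ s := by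
  rw [zeta_eq_tsum_one_div_nat_add_one_cpow hs,
    tsum_pnat_eq_tsum_succ (f := fun n : ℕ => 1 / (n : ℂ) ^ s)]
  push_cast
  rfl

/-- The form is even, so the rows `k` and `-k` agree, and the row `k = 0` is `2 ζ(2 s)`. -/
theorem tsum_one_div_qTri_cpow {s : ℂ} (hs : 1 < s.re) :
    ∑' p : ℤ × ℤ, 1 / (qTri p : ℂ) ^ s =
      2 * riemannZeta (2 * s) + 2 * ∑' k : ℕ+, ∑' m : ℤ, 1 / (qTri (m, (k : ℤ)) : ℂ) ^ s := by
  have hsum := summable_one_div_qTri_cpow hs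
  have hs2 : 1 < (2 * s).re := by norm_num; linarith
  have hsum' : Summable fun p : ℤ × ℤ => 1 / (qTri (p.2, p.1) : ℂ) ^ s :=
    (Equiv.prodComm ℤ ℤ).summable_iff.mpr hsum
  have hcomm : ∑' p : ℤ × ℤ, 1 / (qTri p : ℂ) ^ s = ∑' p : ℤ × ℤ, 1 / (qTri (p.2, p.1) : ℂ) ^ s :=
    ((Equiv.prodComm ℤ ℤ).tsum_eq _).symm
  rw [hcomm, hsum'.tsum_prod,
    tsum_int_eq_zero_add_two_mul_tsum_pnat ?_ hsum'.prod]
  · rw [nsmul_eq_mul, Nat.cast_ofNat]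
    congr 1
    rw [tsum_int_eq_zero_add_two_mul_tsum_pnat ?_]
    · rw [riemannZeta_eq_tsum_pnat hs2]
      simp only [qTri, Int.cast_zero]
      norm_num
      rw [Complex.zero_cpow (ne_zero_of_one_lt_re hs), inv_zero, zero_add]
      congr 1
      refine tsum_congr fun n => ?_
      have := cpow_two_mul_eq (x := (n : ℝ)) (by positivity) s
      push_cast at this
      rw [this]
    · exact hsum.comp_injective (fun a b h => (Prod.mk.inj h).1)
    · intro n
      simp [qTri]
  · intro k
    dsimp only
    rw [← (Equiv.neg ℤ).tsum_eq]
    simp [qTri]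

/-! ### The Chowla-Selberg formula by Poisson summation in each row. -/

theorem cos_three_pi_mul (k n : ℕ) :
    Real.cos (2 * π * (-(3 * k / 2)) * n) = (-1) ^ (n * k) := by
  rw [show 2 * π * (-(3 * (k : ℝ) / 2)) * n = -(((3 * (n * k) : ℕ) : ℝ) * π) by push_cast; ring,
    Real.cos_neg, Real.cos_nat_mul_pi, pow_mul]
  norm_num

/-- The term of the dual sum belonging to the pair `(n, k)`. -/
noncomputable def dualTerm (s : ℂ) (n k : ℕ) : ℂ :=
  ((n / (k * (√3 / 2)) : ℝ) : ℂ) ^ (s - 1 / 2) * ∫ x in Ioi (0 : ℝ), besselIntegrand s (n * k) x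

/-- The integrand whose integral is `dualTerm`. -/
noncomputable def dualIntegrand (s : ℂ) (n k : ℕ) (t : ℝ) : ℂ :=
  (t : ℂ) ^ (s - 1 / 2 - 1) * (rexp (-π * (3 * k ^ 2 / 4) * t) * rexp (-π * n ^ 2 * t⁻¹) : ℝ)

/-- Rescaling `t` balances the coefficients of `t` and `t⁻¹` in the exponent; both become `π n k √3
/ 2`, so that only the product `n k` remains in the kernel. -/
theorem dualIntegrand_eq (s : ℂ) {n k : ℕ} (hn : 0 < n) (hk : 0 < k) {t : ℝ} (ht : 0 < t) :
    dualIntegrand s n k t = (t : ℂ) ^ (s - 1 / 2 - 1) •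
      (fun x : ℝ => (rexp (-(π * ((n * k : ℕ) : ℝ) * √3 / 2) * (x + x⁻¹)) : ℂ))
        ((k * (√3 / 2) / n) * t) := by
  have h3 : √3 ^ 2 = 3 := sq_sqrt (by norm_num)
  have hk' : (0 : ℝ) < k := by exact_mod_cast hk
  have hn' : (0 : ℝ) < n := by exact_mod_cast hn
  rw [dualIntegrand, smul_eq_mul, ← exp_add]
  congr 3
  push_cast
  field_simp
  rw [h3]
  ring

theorem dualIntegrand_integrableOn (s : ℂ) {n k : ℕ} (hn : 0 < n) (hk : 0 < k) :
    IntegrableOn (dualIntegrand s n k) (Ioi 0) := by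
  have ha : (0 : ℝ) < k * (√3 / 2) / n := by positivity
  have h := (mellinConvergent_exp_neg_mul_add_inv (c := π * ((n * k : ℕ) : ℝ) * √3 / 2)
    (by positivity) (s - 1 / 2))
  have h' := (MellinConvergent.comp_mul_left ha).mpr h
  exact IntegrableOn.congr_fun h' (fun t ht => (dualIntegrand_eq s hn hk ht).symm) measurableSet_Ioi

theorem integral_dualIntegrand (s : ℂ) {n k : ℕ} (hn : 0 < n) (hk : 0 < k) :
    ∫ t in Ioi (0 : ℝ), dualIntegrand s n k t = dualTerm s n k := by
  have ha : (0 : ℝ) < k * (√3 / 2) / n := by positivity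
  rw [setIntegral_congr_fun measurableSet_Ioi (fun t ht => dualIntegrand_eq s hn hk ht)]
  have h := mellin_comp_mul_left
    (fun x : ℝ => (rexp (-(π * ((n * k : ℕ) : ℝ) * √3 / 2) * (x + x⁻¹)) : ℂ)) (s - 1 / 2) ha
  rw [mellin] at h
  rw [h, dualTerm, integral_besselIntegrand, smul_eq_mul]
  congr 1
  rw [← inv_div (k * (√3 / 2) : ℝ) (n : ℝ), Complex.ofReal_inv, Complex.cpow_neg,
    Complex.inv_cpow]
  rw [Complex.arg_ofReal_of_nonneg ha.le]
  exact pi_pos.ne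

/-- Passing to norms amounts to replacing `s` by `Re s`. Hence the summability needed to exchange
sum and integral is that of the dual sum at a real exponent. -/
theorem norm_dualIntegrand (s : ℂ) (n k : ℕ) {t : ℝ} (ht : 0 < t) :
    (‖dualIntegrand s n k t‖ : ℂ) = dualIntegrand (s.re : ℂ) n k t := by
  rw [dualIntegrand, norm_mul, Complex.norm_real, norm_of_nonneg (by positivity),
    Complex.norm_cpow_eq_rpow_re_of_pos ht, dualIntegrand, Complex.ofReal_mul,
    Complex.ofReal_cpow ht.le]
  norm_num

theorem integral_norm_dualIntegrand (s : ℂ) {n k : ℕ} (hn : 0 < n) (hk : 0 < k) :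
    ((∫ t in Ioi (0 : ℝ), ‖dualIntegrand s n k t‖ : ℝ) : ℂ) = dualTerm (s.re : ℂ) n k := by
  rw [← integral_dualIntegrand _ hn hk, ← integral_complex_ofReal]
  exact setIntegral_congr_fun measurableSet_Ioi fun t ht => norm_dualIntegrand s n k ht

/-- Writing `n / k = (n k) k⁻²` separates the part depending only on `n k` from `k ^ (1 - 2 s)`, the
summand of the divisor sum. -/
theorem natCast_sub_half_cpow (s : ℂ) {n k : ℕ} (hn : 0 < n) (hk : 0 < k) :
    ((n / (k * (√3 / 2)) : ℝ) : ℂ) ^ (s - 1 / 2) =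
      ((2 / √3 : ℝ) : ℂ) ^ (s - 1 / 2) * (((n * k : ℕ) : ℂ) ^ (s - 1 / 2) * (k : ℂ) ^ (1 - 2 * s)) := by
  have hk' : (0 : ℝ) < k := by exact_mod_cast hk
  have hn' : (0 : ℝ) < n := by exact_mod_cast hn
  rw [show (n / (k * (√3 / 2)) : ℝ) = (2 / √3) * (((n * k : ℕ) : ℝ) * ((k : ℝ)⁻¹ ^ 2)) by
      push_cast; field_simp,
    Complex.ofReal_mul, Complex.mul_cpow_ofReal_nonneg (by positivity) (by positivity),
    Complex.ofReal_mul, Complex.mul_cpow_ofReal_nonneg (by positivity) (by positivity),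
    ← cpow_two_mul_eq (by positivity), Complex.ofReal_inv, Complex.inv_cpow,
    ← Complex.cpow_neg]
  · congr 3
    ring
  · rw [Complex.arg_ofReal_of_nonneg hk'.le]
    exact pi_pos.ne

theorem norm_dualTerm_le (R : ℕ) :
    ∃ C : ℝ, 0 ≤ C ∧ ∀ s : ℂ, |s.re| ≤ R → ∀ n k : ℕ, 0 < n → 0 < k →
      ‖dualTerm s n k‖ ≤ ‖((2 / √3 : ℝ) : ℂ) ^ (s - 1 / 2)‖ *
        (C * (((n * k : ℕ) : ℝ) ^ (3 * R + 1) * rexp (-(π * √3) * (n * k : ℕ)))) := by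
  obtain ⟨C, hC, h⟩ := exists_norm_integral_besselIntegrand_le R
  refine ⟨C * rexp (π * √3), by positivity, fun s hs n k hn hk => ?_⟩
  have hnk := Nat.mul_pos hn hk
  have hN : (1 : ℝ) ≤ ((n * k : ℕ) : ℝ) := by exact_mod_cast hnk
  have hk1 : (1 : ℝ) ≤ k := by exact_mod_cast hk
  have hkN : (k : ℝ) ≤ ((n * k : ℕ) : ℝ) := by exact_mod_cast Nat.le_mul_of_pos_left k hn
  have hs' := abs_le.mp hs
  rw [dualTerm, norm_mul, natCast_sub_half_cpow s hn hk, norm_mul, mul_assoc, norm_mul]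
  have h1 : ‖((n * k : ℕ) : ℂ) ^ (s - 1 / 2)‖ ≤ ((n * k : ℕ) : ℝ) ^ R := by
    rw [Complex.norm_natCast_cpow_of_pos hnk, ← rpow_natCast]
    refine rpow_le_rpow_of_exponent_le hN ?_
    norm_num
    linarith
  have h2 : ‖(k : ℂ) ^ (1 - 2 * s)‖ ≤ ((n * k : ℕ) : ℝ) ^ (1 + 2 * R) := by
    rw [Complex.norm_natCast_cpow_of_pos hk]
    refine (rpow_le_rpow_of_exponent_le hk1
      (show (1 - 2 * s).re ≤ ((1 + 2 * R : ℕ) : ℝ) by norm_num; linarith)).trans ?_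
    rw [rpow_natCast]
    gcongr
  refine mul_le_mul_of_nonneg_left ?_ (norm_nonneg _)
  calc _ ≤ (((n * k : ℕ) : ℝ) ^ R * ((n * k : ℕ) : ℝ) ^ (1 + 2 * R)) *
        (C * rexp (-(π * √3) * ((n * k : ℕ) - 1))) := by
        gcongr
        exact (norm_integral_le_integral_norm _).trans (h s hs _ hnk)
    _ = _ := by
        rw [show -(π * √3) * (((n * k : ℕ) : ℝ) - 1) = π * √3 + -(π * √3) * (n * k : ℕ) by ring,
          exp_add]
        ring

/-- From `2 n k ≥ n + k` the exponential is at most `exp (-π √3 n / 2) * exp (-π √3 k / 2)`, so the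
double series is dominated by a product of two convergent series. -/
theorem summable_dualTerm (s : ℂ) :
    Summable fun p : ℕ+ × ℕ+ => (-1) ^ ((p.1 : ℕ) * p.2) * dualTerm s p.1 p.2 := by
  obtain ⟨R, hR⟩ := exists_nat_abs_re_le s
  obtain ⟨C, hC, h⟩ := norm_dualTerm_le R
  have h3 : 0 < π * √3 := by positivity
  have hs := (summable_pow_mul_exp_neg_nat_mul (3 * R + 1) (half_pos h3)).comp_injective
    PNat.coe_injective
  have key : Summable fun p : ℕ+ × ℕ+ =>
      (((p.1 * p.2 : ℕ) : ℝ) ^ (3 * R + 1) * rexp (-(π * √3) * (p.1 * p.2 : ℕ))) := by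
    refine Summable.of_nonneg_of_le (fun p => by positivity) (fun p => ?_)
      (hs.mul_of_nonneg hs (fun n => by dsimp; positivity) (fun n => by dsimp; positivity))
    have h1 : (1 : ℝ) ≤ p.1 := by exact_mod_cast p.1.pos
    have h2 : (1 : ℝ) ≤ p.2 := by exact_mod_cast p.2.pos
    simp only [Function.comp_apply]
    rw [mul_mul_mul_comm, ← mul_pow, ← exp_add]
    push_cast
    gcongr
    have h4 : 0 ≤ π * √3 * (2 * (p.1 * p.2) - p.1 - p.2) := mul_nonneg h3.le (by nlinarith)
    linarith
  refine Summable.of_norm_bounded ((key.mul_left C).mul_left ‖((2 / √3 : ℝ) : ℂ) ^ (s - 1 / 2)‖)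
    fun p => ?_
  rw [norm_mul, norm_pow, norm_neg, norm_one, one_pow, one_mul]
  exact h s hR _ _ p.1.pos p.2.pos

theorem dualIntegrand_zero (s : ℂ) (k : ℕ) (t : ℝ) :
    dualIntegrand s 0 k t =
      (t : ℂ) ^ (s - 1 / 2 - 1) * Complex.exp (-((π * (3 * k ^ 2 / 4) : ℝ) : ℂ) * t) := by
  rw [dualIntegrand]
  push_cast
  simp

theorem integral_dualIntegrand_zero {s : ℂ} (hs : 1 < s.re) {k : ℕ} (hk : 0 < k) :
    ∫ t in Ioi (0 : ℝ), dualIntegrand s 0 k t =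
      (1 / ((π * (3 * k ^ 2 / 4) : ℝ) : ℂ)) ^ (s - 1 / 2) * Complex.Gamma (s - 1 / 2) := by
  have hk' : (0 : ℝ) < k := by exact_mod_cast hk
  have h := Complex.integral_cpow_mul_exp_neg_mul_Ioi (a := s - 1 / 2)
    (r := ((π * (3 * k ^ 2 / 4) : ℝ))) (by norm_num; linarith)
    (by positivity)
  simp_rw [dualIntegrand_zero]
  rw [← h]
  simp_rw [neg_mul]

theorem dualIntegrand_zero_integrableOn {s : ℂ} (hs : 1 < s.re) {k : ℕ} (hk : 0 < k) :
    IntegrableOn (dualIntegrand s 0 k) (Ioi 0) := by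
  have hk' : (0 : ℝ) < k := by exact_mod_cast hk
  -- The integral of a non-integrable function is `0` by convention, so the nonzero Gamma value
  -- already found proves integrability.
  refine Integrable.of_integral_ne_zero ?_
  rw [integral_dualIntegrand_zero hs hk]
  refine mul_ne_zero ?_ (Complex.Gamma_ne_zero_of_re_pos (by norm_num; linarith))
  rw [Complex.cpow_ne_zero_iff_of_exponent_ne_zero]
  · exact one_div_ne_zero (by exact_mod_cast (by positivity))
  · intro h
    have := congrArg Complex.re h
    norm_num at this
    linarith

/-- Since `qTri (m, k) = (m - 3 k / 2)² + 3 k² / 4`, the row is the Mellin transform of a theta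
series shifted by `-3 k / 2` and damped by a fixed exponential. -/
theorem one_div_qTri_hasSum_mellin {s : ℂ} (hs : 1 < s.re) {k : ℕ} (hk : 0 < k) :
    HasSum (fun m : ℤ => (π : ℂ) ^ (-s) * Complex.Gamma s * 1 / (qTri (m, (k : ℤ)) : ℂ) ^ s)
      (mellin (fun t : ℝ => ((rexp (-π * (3 * k ^ 2 / 4) * t) *
        HurwitzZeta.evenKernel ((-(3 * k / 2) : ℝ) : UnitAddCircle) t : ℝ) : ℂ)) s) := by
  have hk' : (k : ℤ) ≠ 0 := by exact_mod_cast hk.ne'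
  refine hasSum_mellin_pi_mul (a := fun _ => 1) (q := fun m : ℤ => qTri (m, (k : ℤ)))
    (fun m => Or.inr (qTri_pos ?_)) (by linarith) (fun t ht => ?_) ?_
  · exact fun h => hk' (congrArg Prod.snd h)
  · have h := (HurwitzZeta.hasSum_int_evenKernel (-(3 * k / 2)) ht).mul_left
      (rexp (-π * (3 * k ^ 2 / 4) * t))
    refine (Complex.hasSum_ofReal.mpr h).congr_fun fun m => ?_
    rw [one_mul, ← exp_add]
    congr 2
    simp only [qTri, Int.cast_natCast]
    ring
  · have h := (summable_one_div_qTri_cpow hs).norm.comp_injective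
      (i := fun m : ℤ => (m, (k : ℤ))) fun _ _ h => (Prod.mk.inj h).1
    refine h.congr fun m => ?_
    rw [Function.comp_apply, norm_one_div_qTri_cpow hs, rpow_neg (qTri_nonneg _), norm_one, one_div]

theorem summable_dualTerm_left (s : ℂ) {k : ℕ} (hk : 0 < k) :
    Summable fun n : ℕ+ => (-1) ^ ((n : ℕ) * k) * dualTerm s n k :=
  (summable_dualTerm s).comp_injective (i := fun n : ℕ+ => (n, (⟨k, hk⟩ : ℕ+)))
    fun _ _ h => (Prod.mk.inj h).1

/-- The theta functional equation turns the shift into the phases `cos (3 π n k) = (-1) ^ (n k)`.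
The dual series is then integrated term by term: `n = 0` gives a Gamma integral, the others Bessel
integrals. -/
theorem mellin_evenKernel {s : ℂ} (hs : 1 < s.re) {k : ℕ} (hk : 0 < k) :
    mellin (fun t : ℝ => ((rexp (-π * (3 * k ^ 2 / 4) * t) *
        HurwitzZeta.evenKernel ((-(3 * k / 2) : ℝ) : UnitAddCircle) t : ℝ) : ℂ)) s =
      (1 / ((π * (3 * k ^ 2 / 4) : ℝ) : ℂ)) ^ (s - 1 / 2) * Complex.Gamma (s - 1 / 2) +
        2 * ∑' n : ℕ+, (-1) ^ ((n : ℕ) * k) * dualTerm s n k := by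
  -- The frequencies `n` and `-n` are merged, whence the factor `2` except at `n = 0`.
  set c : ℕ → ℂ := fun n => if n = 0 then 1 else 2 * (-1) ^ (n * k) with hc
  have hpt : ∀ t ∈ Ioi (0 : ℝ), HasSum (fun n : ℕ => c n * dualIntegrand s n k t)
      ((t : ℂ) ^ (s - 1) • ((rexp (-π * (3 * k ^ 2 / 4) * t) *
        HurwitzZeta.evenKernel ((-(3 * k / 2) : ℝ) : UnitAddCircle) t : ℝ) : ℂ)) := by
    intro t ht
    have ht : 0 < t := ht
    rw [← hasSum_nat_add_iff' 1]
    have h := Complex.hasSum_ofReal.mpr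
      (HurwitzZeta.hasSum_nat_cosKernel₀ (-(3 * k / 2)) (inv_pos.mpr ht))
    have h2 := h.mul_left ((t : ℂ) ^ (s - 1 / 2 - 1) * (rexp (-π * (3 * k ^ 2 / 4) * t) : ℝ))
    have hval : (t : ℂ) ^ (s - 1) • ((rexp (-π * (3 * k ^ 2 / 4) * t) *
          HurwitzZeta.evenKernel ((-(3 * k / 2) : ℝ) : UnitAddCircle) t : ℝ) : ℂ) -
          ∑ n ∈ Finset.range 1, c n * dualIntegrand s n k t =
        (t : ℂ) ^ (s - 1 / 2 - 1) * (rexp (-π * (3 * k ^ 2 / 4) * t) : ℝ) *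
          ((HurwitzZeta.cosKernel ((-(3 * k / 2) : ℝ) : UnitAddCircle) t⁻¹ - 1 : ℝ) : ℂ) := by
      rw [Finset.sum_range_one, dualIntegrand, HurwitzZeta.evenKernel_functional_equation,
        show s - 1 = (s - 1 / 2 - 1) + 1 / 2 by ring,
        Complex.cpow_add _ _ (by exact_mod_cast ht.ne'), one_div t]
      have h5 : ((t ^ (1 / 2 : ℝ) : ℝ) : ℂ) = (t : ℂ) ^ (1 / 2 : ℂ) := by
        rw [Complex.ofReal_cpow ht.le]
        norm_num
      have h6 : (t : ℂ) ^ (1 / 2 : ℂ) ≠ 0 := by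
        rw [← h5]
        exact_mod_cast (by positivity)
      push_cast [h5, hc]
      simp
      field_simp
    rw [hval]
    refine h2.congr_fun fun n => ?_
    have h7 := cos_three_pi_mul k (n + 1)
    push_cast at h7
    rw [h7, dualIntegrand]
    simp [hc]
    ring
  rw [mellin, setIntegral_congr_fun measurableSet_Ioi fun t ht => (hpt t ht).tsum_eq.symm]
  have hint : ∀ n : ℕ, IntegrableOn (fun t => c n * dualIntegrand s n k t) (Ioi 0) := by
    intro n
    rcases Nat.eq_zero_or_pos n with rfl | hn
    · exact (dualIntegrand_zero_integrableOn hs hk).const_mul _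
    · exact (dualIntegrand_integrableOn s hn hk).const_mul _
  have hnorm : Summable fun n : ℕ => ∫ t in Ioi (0 : ℝ), ‖c n * dualIntegrand s n k t‖ := by
    rw [← summable_nat_add_iff 1]
    have h := (summable_dualTerm_left (s.re : ℂ) hk).norm.mul_left 2
    rw [← Equiv.pnatEquivNat.symm.summable_iff] at h
    refine h.congr fun n => ?_
    simp only [Function.comp_apply, Equiv.pnatEquivNat_symm_apply, Nat.succPNat_coe,
      Nat.succ_eq_add_one]
    rw [← integral_norm_dualIntegrand s n.succ_pos hk, norm_mul, norm_pow, norm_neg, norm_one,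
      one_pow, one_mul, Complex.norm_real, norm_of_nonneg (by positivity), ← integral_const_mul]
    simp [hc]
  have hmain := hasSum_integral_of_summable_integral_norm hint hnorm
  rw [← hmain.tsum_eq, hmain.summable.tsum_eq_zero_add, integral_const_mul,
    integral_dualIntegrand_zero hs hk, ← tsum_mul_left]
  simp only [hc, if_true, one_mul]
  congr 1
  rw [tsum_pnat_eq_tsum_succ (f := fun n => 2 * ((-1) ^ ((n : ℕ) * k) * dualTerm s n k))]
  refine tsum_congr fun n => ?_
  rw [integral_const_mul, integral_dualIntegrand s n.succ_pos hk]
  simp [mul_assoc]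

/-- Pairs `(n, k)` are grouped by their product `N`: sign and integral depend on `N` alone, and `k`
runs through the divisors of `N`. -/
theorem tsum_besselTerm (s : ℂ) :
    ∑' p : ℕ+ × ℕ+, (-1) ^ ((p.1 : ℕ) * p.2) * dualTerm s p.1 p.2 =
      ((2 / √3 : ℝ) : ℂ) ^ (s - 1 / 2) * ∑' n : ℕ+, besselTerm s n := by
  have hsum := sigmaAntidiagonalEquivProd.summable_iff.mpr (summable_dualTerm s)
  rw [Function.comp_def] at hsum
  rw [← sigmaAntidiagonalEquivProd.tsum_eq, hsum.tsum_sigma, ← tsum_mul_left]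
  refine tsum_congr fun n => ?_
  have hterm : ∀ d : Nat.divisorsAntidiagonal n,
      (-1) ^ (((sigmaAntidiagonalEquivProd ⟨n, d⟩).1 : ℕ) * (sigmaAntidiagonalEquivProd ⟨n, d⟩).2) *
        dualTerm s (sigmaAntidiagonalEquivProd ⟨n, d⟩).1 (sigmaAntidiagonalEquivProd ⟨n, d⟩).2 =
      (fun x : ℕ × ℕ => ((2 / √3 : ℝ) : ℂ) ^ (s - 1 / 2) * ((n : ℂ) ^ (s - 1 / 2) *
        ((x.2 : ℂ) ^ (1 - 2 * s) * (-1) ^ (n : ℕ)) * ∫ x in Ioi (0 : ℝ), besselIntegrand s n x)) d.1 := by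
    intro d
    have hd := (Nat.mem_divisorsAntidiagonal.mp d.2).1
    have hd1 : 0 < d.1.1 := Nat.pos_of_ne_zero fun h => n.ne_zero (by rw [← hd, h, zero_mul])
    have hd2 : 0 < d.1.2 := Nat.pos_of_ne_zero fun h => n.ne_zero (by rw [← hd, h, mul_zero])
    have e1 : ((sigmaAntidiagonalEquivProd ⟨n, d⟩).1 : ℕ) = d.1.1 := rfl
    have e2 : ((sigmaAntidiagonalEquivProd ⟨n, d⟩).2 : ℕ) = d.1.2 := rfl
    rw [e1, e2, dualTerm, natCast_sub_half_cpow s hd1 hd2, hd]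
    ring
  rw [tsum_fintype]
  simp_rw [hterm]
  rw [Finset.sum_coe_sort (Nat.divisorsAntidiagonal n) (fun x : ℕ × ℕ => ((2 / √3 : ℝ) : ℂ) ^ (s - 1 / 2) * ((n : ℂ) ^ (s - 1 / 2) *
        ((x.2 : ℂ) ^ (1 - 2 * s) * (-1) ^ (n : ℕ)) * ∫ x in Ioi (0 : ℝ), besselIntegrand s n x)),
    ← Finset.mul_sum, besselTerm, ← Finset.sum_mul, ← Finset.mul_sum,
    Nat.sum_divisorsAntidiagonal' (fun _ d => (d : ℂ) ^ (1 - 2 * s) * (-1) ^ (n : ℕ))]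

theorem tsum_one_div_qTri_left {s : ℂ} (hs : 1 < s.re) {k : ℕ} (hk : 0 < k) :
    ∑' m : ℤ, 1 / (qTri (m, (k : ℤ)) : ℂ) ^ s =
      (π : ℂ) ^ s / Complex.Gamma s *
        ((1 / ((π * (3 * k ^ 2 / 4) : ℝ) : ℂ)) ^ (s - 1 / 2) * Complex.Gamma (s - 1 / 2) +
          2 * ∑' n : ℕ+, (-1) ^ ((n : ℕ) * k) * dualTerm s n k) := by
  have h := (one_div_qTri_hasSum_mellin hs hk).tsum_eq
  rw [tsum_congr fun m : ℤ => mul_div_assoc _ (1 : ℂ) _, tsum_mul_left] at h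
  rw [mellin_evenKernel hs hk] at h
  have hG : Complex.Gamma s ≠ 0 := Complex.Gamma_ne_zero_of_re_pos (by linarith)
  have hpi : (π : ℂ) ^ s ≠ 0 := by
    rw [Complex.cpow_ne_zero_iff_of_exponent_ne_zero (ne_zero_of_one_lt_re hs)]
    exact_mod_cast pi_ne_zero
  rw [← h, Complex.cpow_neg]
  field_simp

theorem one_div_cpow_eq (s : ℂ) (k : ℕ) :
    (1 / ((π * (3 * k ^ 2 / 4) : ℝ) : ℂ)) ^ (s - 1 / 2) =
      ((4 / (3 * π) : ℝ) : ℂ) ^ (s - 1 / 2) * (1 / (k : ℂ) ^ (2 * s - 1)) := by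
  have h1 : (1 / ((π * (3 * k ^ 2 / 4) : ℝ) : ℂ)) = ((4 / (3 * π) : ℝ) : ℂ) * (((k : ℝ)⁻¹ ^ 2 : ℝ) : ℂ) := by
    push_cast
    ring_nf
  rw [h1, Complex.mul_cpow_ofReal_nonneg (by positivity) (by positivity),
    ← cpow_two_mul_eq (by positivity), Complex.ofReal_inv, Complex.inv_cpow,
    one_div ((k : ℂ) ^ (2 * s - 1))]
  · rw [Complex.ofReal_natCast, show 2 * (s - 1 / 2) = 2 * s - 1 by ring]
  · rw [Complex.arg_ofReal_of_nonneg (by positivity)]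
    exact pi_pos.ne

theorem tsum_one_div_qTri_eq {s : ℂ} (hs : 1 < s.re) :
    ∑' p : ℤ × ℤ, 1 / (qTri p : ℂ) ^ s = 2 * riemannZeta (2 * s) +
      2 * (π : ℂ) ^ s / Complex.Gamma s *
        (((4 / (3 * π) : ℝ) : ℂ) ^ (s - 1 / 2) * riemannZeta (2 * s - 1) * Complex.Gamma (s - 1 / 2) +
          2 * (((2 / √3 : ℝ) : ℂ) ^ (s - 1 / 2) * ∑' n : ℕ+, besselTerm s n)) := by
  have hz : 1 < (2 * s - 1).re := by norm_num; linarith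
  have hz1 : Summable fun k : ℕ+ => 1 / (k : ℂ) ^ (2 * s - 1) :=
    (Complex.summable_one_div_nat_cpow.mpr hz).comp_injective PNat.coe_injective
  have hdual : Summable fun p : ℕ+ × ℕ+ => (-1) ^ ((p.2 : ℕ) * p.1) * dualTerm s p.2 p.1 :=
    (Equiv.prodComm ℕ+ ℕ+).summable_iff.mpr (summable_dualTerm s)
  have hcomm : ∑' p : ℕ+ × ℕ+, (-1) ^ ((p.1 : ℕ) * p.2) * dualTerm s p.1 p.2 =
      ∑' p : ℕ+ × ℕ+, (-1) ^ ((p.2 : ℕ) * p.1) * dualTerm s p.2 p.1 :=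
    ((Equiv.prodComm ℕ+ ℕ+).tsum_eq _).symm
  rw [tsum_one_div_qTri_cpow hs, tsum_congr fun k : ℕ+ => tsum_one_div_qTri_left hs k.pos,
    tsum_mul_left, Summable.tsum_add, tsum_mul_left, ← tsum_besselTerm, hcomm, hdual.tsum_prod]
  · simp_rw [one_div_cpow_eq]
    rw [tsum_mul_right, tsum_mul_left, ← riemannZeta_eq_tsum_pnat hz]
    ring
  · simp_rw [one_div_cpow_eq]
    exact (hz1.mul_left _).mul_right _
  · exact hdual.prod.mul_left 2

theorem two_mul_pi_cpow_mul (s : ℂ) :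
    2 * (π : ℂ) ^ s * ((4 / (3 * π) : ℝ) : ℂ) ^ (s - 1 / 2) =
      2 ^ (2 * s) * (√π : ℝ) / 3 ^ (s - 1 / 2) := by
  have h1 : ((4 / (3 * π) : ℝ) : ℂ) ^ (s - 1 / 2) =
      2 ^ (2 * (s - 1 / 2)) * ((3 : ℂ) ^ (s - 1 / 2))⁻¹ * ((π : ℂ) ^ (s - 1 / 2))⁻¹ := by
    rw [show (4 / (3 * π) : ℝ) = 2 ^ 2 * (3⁻¹ * π⁻¹) by ring, Complex.ofReal_mul,
      Complex.mul_cpow_ofReal_nonneg (by positivity) (by positivity), Complex.ofReal_mul,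
      Complex.mul_cpow_ofReal_nonneg (by positivity) (by positivity),
      ← cpow_two_mul_eq (by positivity), Complex.ofReal_inv, Complex.ofReal_inv, Complex.inv_cpow,
      Complex.inv_cpow]
    · push_cast
      ring
    · rw [Complex.arg_ofReal_of_nonneg (by positivity)]
      exact pi_pos.ne
    · rw [Complex.arg_ofReal_of_nonneg (by positivity)]
      exact pi_pos.ne
  have h2 : (π : ℂ) ^ s = (π : ℂ) ^ (s - 1 / 2) * (√π : ℝ) := by
    rw [sqrt_eq_rpow, Complex.ofReal_cpow pi_pos.le, ← Complex.cpow_add _ _ (by simp [pi_ne_zero])]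
    norm_num
  have h3 : (2 : ℂ) ^ (2 * s) = 2 ^ (2 * (s - 1 / 2)) * 2 := by
    rw [show 2 * s = 2 * (s - 1 / 2) + 1 by ring, Complex.cpow_add _ _ two_ne_zero, Complex.cpow_one]
  have h4 : (π : ℂ) ^ (s - 1 / 2) ≠ 0 := by simp [Complex.cpow_eq_zero_iff, pi_ne_zero]
  rw [h1, h2, h3]
  field_simp

theorem two_div_sqrt_three_cpow (s : ℂ) :
    ((2 / √3 : ℝ) : ℂ) ^ (s - 1 / 2) = 2 ^ (s - 1 / 2) / 3 ^ (s / 2 - 1 / 4) := by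
  have h := cpow_two_mul_eq (sqrt_nonneg 3) (s / 2 - 1 / 4)
  rw [sq_sqrt (by norm_num), show 2 * (s / 2 - 1 / 4) = s - 1 / 2 by ring] at h
  rw [div_eq_mul_inv (2 : ℝ), Complex.ofReal_mul,
    Complex.mul_cpow_ofReal_nonneg (by positivity) (by positivity), Complex.ofReal_inv,
    Complex.inv_cpow, h]
  · push_cast
    ring
  · rw [Complex.arg_ofReal_of_nonneg (by positivity)]
    exact pi_pos.ne

theorem chowlaSelbergTri_eq (ℓ : ℝ) (s : ℂ) :
    chowlaSelbergTri ℓ s = 1 / 6 * ((3 * ℓ / (4 * π) : ℝ) : ℂ) ^ (2 * s) *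
      ((2 * riemannZeta (2 * s) +
      2 * (π : ℂ) ^ s / Complex.Gamma s *
        (((4 / (3 * π) : ℝ) : ℂ) ^ (s - 1 / 2) * riemannZeta (2 * s - 1) * Complex.Gamma (s - 1 / 2) +
          2 * (((2 / √3 : ℝ) : ℂ) ^ (s - 1 / 2) * ∑' n : ℕ+, besselTerm s n)))
        - 6 * riemannZeta (2 * s)) := by
  rw [chowlaSelbergTri, two_div_sqrt_three_cpow]
  congr 1
  have h := two_mul_pi_cpow_mul s
  have e : 2 ^ (2 * s) * ((√π : ℝ) : ℂ) * riemannZeta (2 * s - 1) * Complex.Gamma (s - 1 / 2)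
      / (Complex.Gamma s * 3 ^ (s - 1 / 2)) =
    (2 ^ (2 * s) * (√π : ℝ) / 3 ^ (s - 1 / 2)) * (riemannZeta (2 * s - 1) * Complex.Gamma (s - 1 / 2)
      / Complex.Gamma s) := by
    ring
  rw [e, ← h]
  ring

theorem length_cpow_eq {ℓ : ℝ} (hℓ : 0 < ℓ) (s : ℂ) :
    ((3 * ℓ / (4 * π) : ℝ) : ℂ) ^ (2 * s) = ((3 * ℓ / 4 : ℝ) : ℂ) ^ (2 * s) * (1 / (π : ℂ) ^ (2 * s)) := by
  rw [show (3 * ℓ / (4 * π) : ℝ) = 3 * ℓ / 4 * π⁻¹ by field_simp, Complex.ofReal_mul,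
    Complex.mul_cpow_ofReal_nonneg (by positivity) (by positivity), Complex.ofReal_inv,
    Complex.inv_cpow, one_div]
  rw [Complex.arg_ofReal_of_nonneg (by positivity)]
  exact pi_pos.ne

theorem epsteinExpression_eq {ℓ : ℝ} (hℓ : 0 < ℓ) (s g : ℂ) :
    epsteinExpression ℓ s (1 / (π : ℂ) ^ (2 * s) * g) =
      1 / 6 * ((3 * ℓ / (4 * π) : ℝ) : ℂ) ^ (2 * s) * (g - 6 * riemannZeta (2 * s)) := by
  rw [epsteinExpression, length_cpow_eq hℓ]
  ring

theorem epsteinExpression_epsteinTri {ℓ : ℝ} (hℓ : 0 < ℓ) {s : ℂ} (hs : 1 < s.re) :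
    epsteinExpression ℓ s (epsteinTri s) = chowlaSelbergTri ℓ s := by
  rw [epsteinTri_eq hs, epsteinExpression_eq hℓ, chowlaSelbergTri_eq, tsum_one_div_qTri_eq hs]

/-! ### Sixfold symmetry of the hexagonal lattice. -/

/-- The quadratic form of the hexagonal lattice. -/
noncomputable def hexForm (p : ℤ × ℤ) : ℝ := (p.1 : ℝ) ^ 2 + p.1 * p.2 + (p.2 : ℝ) ^ 2

/-- The shear that turns `hexForm` into `qTri`. -/
def shearEquiv : ℤ × ℤ ≃ ℤ × ℤ where
  toFun p := (p.1 + 2 * p.2, p.2)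
  invFun p := (p.1 - 2 * p.2, p.2)
  left_inv p := by ext <;> simp
  right_inv p := by ext <;> simp

theorem qTri_shearEquiv (p : ℤ × ℤ) : qTri (shearEquiv p) = hexForm p := by
  simp only [qTri, shearEquiv, Equiv.coe_fn_mk, hexForm]
  push_cast
  ring

/-- The rotation by a sixth of a turn of the hexagonal lattice. -/
def hexRotation : ℤ × ℤ ≃ ℤ × ℤ where
  toFun p := (-p.2, p.1 + p.2)
  invFun p := (p.1 + p.2, -p.1)
  left_inv p := by ext <;> simp
  right_inv p := by ext <;> simp

theorem hexForm_hexRotation (p : ℤ × ℤ) : hexForm (hexRotation p) = hexForm p := by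
  simp only [hexRotation, Equiv.coe_fn_mk, hexForm]
  push_cast
  ring

theorem summable_one_div_hexForm_cpow {s : ℂ} (hs : 1 < s.re) :
    Summable fun p : ℤ × ℤ => 1 / (hexForm p : ℂ) ^ s := by
  simp_rw [← qTri_shearEquiv]
  exact shearEquiv.summable_iff.mpr (summable_one_div_qTri_cpow hs)

/-- The half-open sector `m > 0, k ≥ 0` and its rotations by multiples of a sixth of a turn
partition the nonzero lattice points. Thus `f` is the sum of six rotated copies of its restriction
to the sector, all with the same total. -/
theorem tsum_eq_six_mul_sector {f : ℤ × ℤ → ℂ} (hf : Summable f) (h0 : f 0 = 0)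
    (hrot : ∀ p, f (hexRotation p) = f p) :
    ∑' p, f p = 6 * (∑' p : ℕ+ × ℕ+, f (p.1, p.2) + ∑' m : ℕ+, f (m, 0)) := by
  set A : Set (ℤ × ℤ) := {p | 0 < p.1 ∧ 0 < p.2} with hA
  set B : Set (ℤ × ℤ) := {p | 0 < p.1 ∧ p.2 = 0} with hB
  set g : ℤ × ℤ → ℂ := fun p => A.indicator f p + B.indicator f p with hg
  have hgv : ∀ a b : ℤ, g (a, b) =
      (if 0 < a ∧ 0 < b then f (a, b) else 0) + if 0 < a ∧ b = 0 then f (a, b) else 0 := by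
    intro a b
    simp only [hg]
    congr 1
    · split_ifs with h
      · exact indicator_of_mem (s := A) h f
      · exact indicator_of_notMem (s := A) h f
    · split_ifs with h
      · exact indicator_of_mem (s := B) h f
      · exact indicator_of_notMem (s := B) h f
  have hgs : Summable g := (hf.indicator A).add (hf.indicator B)
  have hgr : ∀ j : ℕ, Summable (fun p => g (hexRotation^[j] p)) ∧
      ∑' p, g (hexRotation^[j] p) = ∑' p, g p := by
    intro j
    induction j with
    | zero => exact ⟨hgs, rfl⟩
    | succ j ih =>
      simp_rw [Function.iterate_succ_apply]
      exact ⟨hexRotation.summable_iff.mpr ih.1,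
        (hexRotation.tsum_eq fun p => g (hexRotation^[j] p)).trans ih.2⟩
  have hsplit : ∀ p, f p = ∑ j ∈ Finset.range 6, g (hexRotation^[j] p) := by
    rintro ⟨m, k⟩
    have hfr : ∀ j : ℕ, f (hexRotation^[j] (m, k)) = f (m, k) := by
      intro j
      induction j with
      | zero => rfl
      | succ j ih => rw [Function.iterate_succ_apply', hrot, ih]
    by_cases hmk : (m, k) = 0
    · have : ∀ p, f p = 0 → g p = 0 := by
        intro p hp
        simp [hg, indicator_apply, hp]
      rw [Finset.sum_eq_zero fun j _ => this _ ((hfr j).trans (by rw [hmk, h0])), hmk, h0]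
    have hmk' : m ≠ 0 ∨ k ≠ 0 := by
      by_contra h
      push Not at h
      exact hmk (Prod.ext h.1 h.2)
    have hfr1 := hfr 1
    have hfr2 := hfr 2
    have hfr3 := hfr 3
    have hfr4 := hfr 4
    have hfr5 := hfr 5
    simp only [Function.iterate_succ_apply, Function.iterate_zero_apply, hexRotation,
      Equiv.coe_fn_mk] at hfr1 hfr2 hfr3 hfr4 hfr5
    simp only [Finset.sum_range_succ, Finset.sum_range_zero, Function.iterate_succ_apply,
      Function.iterate_zero_apply, hexRotation, Equiv.coe_fn_mk]
    simp only [hgv, hfr1, hfr2, hfr3, hfr4, hfr5]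
    -- Each successive pair of alternatives is the open sector and the ray for one more rotation.
    have hcases : (0 < m ∧ 0 < k) ∨ (0 < m ∧ k = 0) ∨ (0 < -k ∧ 0 < m + k) ∨ (0 < -k ∧ m + k = 0) ∨
      (0 < -m - k ∧ 0 < m) ∨ (0 < -m - k ∧ m = 0) ∨ (0 < -m ∧ 0 < -k) ∨ (0 < -m ∧ k = 0) ∨
      (0 < k ∧ 0 < -m - k) ∨ (0 < k ∧ m + k = 0) ∨ (0 < m + k ∧ 0 < -m) ∨ (0 < m + k ∧ m = 0) := by
      omega
    rcases hcases with h | h | h | h | h | h | h | h | h | h | h | h <;>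
      simp (disch := omega) only [if_pos, if_neg, add_zero, zero_add]
  have hA' : ∑' p, A.indicator f p = ∑' p : ℕ+ × ℕ+, f (p.1, p.2) := by
    have hi : Function.Injective fun p : ℕ+ × ℕ+ => (((p.1 : ℕ) : ℤ), ((p.2 : ℕ) : ℤ)) := by
      rintro ⟨a, b⟩ ⟨c, d⟩ h
      simpa using h
    rw [← hi.tsum_eq]
    · refine tsum_congr fun p => indicator_of_mem ?_ f
      simp [hA]
    · intro p hp
      have hp := (mem_of_indicator_ne_zero hp)
      refine ⟨(⟨p.1.toNat, by have := hp.1; omega⟩, ⟨p.2.toNat, by have := hp.2; omega⟩), ?_⟩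
      have h1 := hp.1
      have h2 := hp.2
      ext <;> simp <;> omega
  have hB' : ∑' p, B.indicator f p = ∑' m : ℕ+, f (m, 0) := by
    have hi : Function.Injective fun m : ℕ+ => (((m : ℕ) : ℤ), (0 : ℤ)) := by
      intro a c h
      simpa using h
    rw [← hi.tsum_eq]
    · refine tsum_congr fun p => indicator_of_mem ?_ f
      simp [hB]
    · intro p hp
      have hp := (mem_of_indicator_ne_zero hp)
      refine ⟨⟨p.1.toNat, by have := hp.1; omega⟩, ?_⟩
      have h1 := hp.1
      have h2 := hp.2
      ext <;> simp <;> omega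
  rw [tsum_congr hsplit, Summable.tsum_finsetSum fun j _ => (hgr j).1,
    Finset.sum_congr rfl fun j _ => (hgr j).2, Finset.sum_const, Finset.card_range, hg,
    Summable.tsum_add (hf.indicator A) (hf.indicator B), hA', hB', nsmul_eq_mul]
  norm_num

theorem tsum_one_div_qTri_eq_sector {s : ℂ} (hs : 1 < s.re) :
    ∑' p : ℤ × ℤ, 1 / (qTri p : ℂ) ^ s =
      6 * ∑' p : ℕ+ × ℕ+, 1 / (hexForm (p.1, p.2) : ℂ) ^ s + 6 * riemannZeta (2 * s) := by
  have hz : 1 < (2 * s).re := by norm_num; linarith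
  rw [← shearEquiv.tsum_eq]
  simp_rw [qTri_shearEquiv]
  rw [tsum_eq_six_mul_sector (summable_one_div_hexForm_cpow hs), riemannZeta_eq_tsum_pnat hz, mul_add]
  · congr 2
    refine tsum_congr fun m => ?_
    have h := cpow_two_mul_eq (x := (m : ℝ)) (by positivity) s
    rw [← Complex.ofReal_natCast, h]
    simp [hexForm]
  · simp [hexForm, Complex.zero_cpow (ne_zero_of_one_lt_re hs)]
  · intro p
    rw [hexForm_hexRotation]

/-! ### Meromorphic continuation of the two zeta functions. -/

/-- The polar terms of the completed zeta function are split off. The one at `s = 0` is absorbed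
through `s Γ(s) = Γ(s + 1)`, leaving a pole only at `1 / 2`. -/
theorem riemannZeta_two_mul {s : ℂ} (hs : s ≠ 1 / 2) :
    riemannZeta (2 * s) = (π : ℂ) ^ s * (completedRiemannZeta₀ (2 * s) * (Complex.Gamma s)⁻¹
      - 1 / 2 * (Complex.Gamma (s + 1))⁻¹ + 1 / 2 * (s - 1 / 2)⁻¹ * (Complex.Gamma s)⁻¹) := by
  rcases eq_or_ne s 0 with rfl | h0
  · simp [riemannZeta_zero]
    norm_num
  have h1 : s - 1 / 2 ≠ 0 := sub_ne_zero.mpr hs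
  have h2 : 1 - 2 * s ≠ 0 := by
    intro h
    apply h1
    linear_combination (-1 / 2) * h
  have hpi : (π : ℂ) ^ s ≠ 0 := by simp [Complex.cpow_eq_zero_iff, pi_ne_zero]
  rw [riemannZeta_def_of_ne_zero (mul_ne_zero two_ne_zero h0), completedRiemannZeta_eq,
    Complex.Gammaℝ_def, Complex.Gamma_add_one s h0, show -(2 * s) / 2 = -s by ring,
    show 2 * s / 2 = s by ring, Complex.cpow_neg, div_eq_mul_inv, mul_inv, inv_inv, mul_inv]
  rw [show s - 1 / 2 = -(1 - 2 * s) / 2 by ring]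
  field_simp
  ring

/-- The excluded points are the poles of `Γ(s - 1 / 2)`, where `Complex.Gamma` has the default value
`0` and the product would not be the continued one. The completed zeta function on the right makes
sense there as well. -/
theorem riemannZeta_mul_Gamma {s : ℂ} (hs : ∀ k : ℕ, s ≠ 1 / 2 - k) :
    riemannZeta (2 * s - 1) * Complex.Gamma (s - 1 / 2) =
      (π : ℂ) ^ (s - 1 / 2) * completedRiemannZeta (2 * s - 1) := by
  have h0 : 2 * s - 1 ≠ 0 := by
    intro h
    apply hs 0
    linear_combination (1 / 2) * h
  have hG : Complex.Gamma (s - 1 / 2) ≠ 0 := by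
    refine Complex.Gamma_ne_zero fun m h => hs m ?_
    linear_combination h
  have hpi : (π : ℂ) ^ (s - 1 / 2) ≠ 0 := by simp [Complex.cpow_eq_zero_iff, pi_ne_zero]
  rw [riemannZeta_def_of_ne_zero h0, Complex.Gammaℝ_def, show -(2 * s - 1) / 2 = -(s - 1 / 2) by ring,
    show (2 * s - 1) / 2 = s - 1 / 2 by ring, Complex.cpow_neg]
  generalize Complex.Gamma (s - 1 / 2) = g at hG ⊢
  field_simp

/-- The regular part at `1` of the continuation of `G_∇`, up to the factor `π ^ (-2 s)`. -/
noncomputable def epsteinRegular (s : ℂ) : ℂ :=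
  2 * (π : ℂ) ^ s * (completedRiemannZeta₀ (2 * s) * (Complex.Gamma s)⁻¹
      - 1 / 2 * (Complex.Gamma (s + 1))⁻¹)
    + 2 * (π : ℂ) ^ s * (Complex.Gamma s)⁻¹ * ((4 / 3 : ℂ) ^ (s - 1 / 2) *
        completedRiemannZeta₀ (2 * s - 1) - 1 / 2 * dslope (fun w : ℂ => (4 / 3 : ℂ) ^ (w - 1 / 2)) (1 / 2) s
      + 2 * (((2 / √3 : ℝ) : ℂ) ^ (s - 1 / 2) * ∑' n : ℕ+, besselTerm s n))

/-- The coefficient of the polar part at `1` of the continuation of `G_∇`. -/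
noncomputable def epsteinPolar (s : ℂ) : ℂ :=
  (π : ℂ) ^ s * (Complex.Gamma s)⁻¹ * (4 / 3 : ℂ) ^ (s - 1 / 2)

/-- The meromorphic continuation of `G_∇`. -/
noncomputable def epsteinContinuation (s : ℂ) : ℂ :=
  1 / (π : ℂ) ^ (2 * s) * (epsteinRegular s + epsteinPolar s * (s - 1)⁻¹)

theorem differentiable_inv_Gamma : Differentiable ℂ fun s : ℂ => (Complex.Gamma s)⁻¹ :=
  Complex.differentiable_one_div_Gamma

theorem differentiable_cpow_const {a : ℂ} (ha : a ≠ 0) {f : ℂ → ℂ} (hf : Differentiable ℂ f) :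
    Differentiable ℂ fun s : ℂ => a ^ f s :=
  hf.const_cpow (Or.inl ha)

theorem differentiable_epsteinRegular : Differentiable ℂ epsteinRegular := by
  have hpi : (π : ℂ) ≠ 0 := by exact_mod_cast pi_ne_zero
  have h1 : Differentiable ℂ fun s : ℂ => (π : ℂ) ^ s := differentiable_cpow_const hpi differentiable_id
  have h2 : Differentiable ℂ fun s : ℂ => (4 / 3 : ℂ) ^ (s - 1 / 2) :=
    differentiable_cpow_const (by norm_num) (by fun_prop)
  have h3 : Differentiable ℂ fun s : ℂ => ((2 / √3 : ℝ) : ℂ) ^ (s - 1 / 2) :=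
    differentiable_cpow_const (by exact_mod_cast (by positivity)) (by fun_prop)
  have h4 : Differentiable ℂ (dslope (fun w : ℂ => (4 / 3 : ℂ) ^ (w - 1 / 2)) (1 / 2)) :=
    differentiableOn_univ.mp ((Complex.differentiableOn_dslope univ_mem).mpr h2.differentiableOn)
  have h5 : Differentiable ℂ fun s : ℂ => (Complex.Gamma (s + 1))⁻¹ :=
    differentiable_inv_Gamma.comp (by fun_prop)
  have h6 : Differentiable ℂ fun s : ℂ => completedRiemannZeta₀ (2 * s) :=
    differentiable_completedZeta₀.comp (by fun_prop)
  have h7 : Differentiable ℂ fun s : ℂ => completedRiemannZeta₀ (2 * s - 1) :=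
    differentiable_completedZeta₀.comp (by fun_prop)
  have h8 := differentiable_inv_Gamma
  have h9 := differentiable_tsum_besselTerm
  unfold epsteinRegular
  exact ((h1.const_mul 2).mul ((h6.mul h8).sub (h5.const_mul _))).add
    (((h1.const_mul 2).mul h8).mul (((h2.mul h7).sub (h4.const_mul _)).add
      ((h3.mul h9).const_mul 2)))

theorem differentiable_epsteinPolar : Differentiable ℂ epsteinPolar := by
  have hpi : (π : ℂ) ≠ 0 := by exact_mod_cast pi_ne_zero
  have h1 : Differentiable ℂ fun s : ℂ => (π : ℂ) ^ s := differentiable_cpow_const hpi differentiable_id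
  have h2 : Differentiable ℂ fun s : ℂ => (4 / 3 : ℂ) ^ (s - 1 / 2) :=
    differentiable_cpow_const (by norm_num) (by fun_prop)
  exact (h1.mul differentiable_inv_Gamma).mul h2

theorem differentiable_one_div_pi_cpow : Differentiable ℂ fun s : ℂ => 1 / (π : ℂ) ^ (2 * s) := by
  have hpi : (π : ℂ) ≠ 0 := by exact_mod_cast pi_ne_zero
  simp_rw [one_div, ← Complex.cpow_neg]
  exact differentiable_cpow_const hpi (by fun_prop)

theorem meromorphic_epsteinContinuation : Meromorphic epsteinContinuation := by
  intro s
  have h1 := (differentiable_one_div_pi_cpow.analyticAt s).meromorphicAt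
  have h2 := (differentiable_epsteinRegular.analyticAt s).meromorphicAt
  have h3 := (differentiable_epsteinPolar.analyticAt s).meromorphicAt
  have h4 : MeromorphicAt (fun s : ℂ => (s - 1)⁻¹) s :=
    ((analyticAt_id.sub analyticAt_const).meromorphicAt).inv
  exact h1.mul (h2.add (h3.mul h4))

theorem analyticOnNhd_epsteinContinuation : AnalyticOnNhd ℂ epsteinContinuation {1}ᶜ := by
  intro s hs
  have h1 := differentiable_one_div_pi_cpow.analyticAt s
  have h2 := differentiable_epsteinRegular.analyticAt s
  have h3 := differentiable_epsteinPolar.analyticAt s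
  have h4 : AnalyticAt ℂ (fun s : ℂ => (s - 1)⁻¹) s :=
    (analyticAt_id.sub analyticAt_const).inv (sub_ne_zero.mpr hs)
  exact h1.mul (h2.add (h3.mul h4))

/-- At `1 / 2` the poles of `ζ(2 s)` and of the completed zeta function at `2 s - 1` have opposite
residues: together they form the difference quotient of `(4 / 3) ^ (s - 1 / 2)`, which `dslope`
extends across the point. -/
theorem epsteinRegular_add_epsteinPolar {s : ℂ} (h1 : s ≠ 1) (hs : ∀ k : ℕ, s ≠ 1 / 2 - k) :
    epsteinRegular s + epsteinPolar s * (s - 1)⁻¹ = 2 * riemannZeta (2 * s) +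
      2 * (π : ℂ) ^ s / Complex.Gamma s *
        (((4 / (3 * π) : ℝ) : ℂ) ^ (s - 1 / 2) * riemannZeta (2 * s - 1) * Complex.Gamma (s - 1 / 2) +
          2 * (((2 / √3 : ℝ) : ℂ) ^ (s - 1 / 2) * ∑' n : ℕ+, besselTerm s n)) := by
  have h2 : s ≠ 1 / 2 := by simpa using hs 0
  have h3 : s - 1 / 2 ≠ 0 := sub_ne_zero.mpr h2
  have h4 : s - 1 ≠ 0 := sub_ne_zero.mpr h1
  have hpi : (π : ℂ) ^ (s - 1 / 2) ≠ 0 := by simp [Complex.cpow_eq_zero_iff, pi_ne_zero]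
  have hq : ((4 / (3 * π) : ℝ) : ℂ) ^ (s - 1 / 2) * (π : ℂ) ^ (s - 1 / 2) = (4 / 3 : ℂ) ^ (s - 1 / 2) := by
    rw [← Complex.mul_cpow_ofReal_nonneg (by positivity) pi_pos.le, ← Complex.ofReal_mul]
    congr 1
    rw [show (4 / (3 * π) * π : ℝ) = 4 / 3 by field_simp]
    norm_num
  rw [riemannZeta_two_mul h2, mul_assoc (_ ^ _), riemannZeta_mul_Gamma hs, ← mul_assoc (_ ^ _), hq,
    completedRiemannZeta_eq, epsteinRegular, epsteinPolar, dslope_of_ne _ h2, slope_def_field,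
    sub_self, Complex.cpow_zero]
  rw [show 1 - (2 * s - 1) = -(2 * (s - 1)) by ring, show 2 * s - 1 = 2 * (s - 1 / 2) by ring]
  set Γi := (Complex.Gamma s)⁻¹ with hΓ
  rw [div_eq_mul_inv _ (Complex.Gamma s), ← hΓ]
  field_simp
  ring

theorem epsteinContinuation_eq {s : ℂ} (hs : 1 < s.re) : epsteinContinuation s = epsteinTri s := by
  rw [epsteinTri_eq hs, epsteinContinuation, epsteinRegular_add_epsteinPolar, tsum_one_div_qTri_eq hs]
  · rintro rfl
    norm_num at hs
  · rintro k rfl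
    norm_num at hs
    have : (0 : ℝ) ≤ k := by positivity
    linarith

theorem isMeromorphicContinuation_epstein :
    IsMeromorphicContinuation epsteinTri epsteinContinuation {1} :=
  ⟨fun _ hs => epsteinContinuation_eq hs, meromorphic_epsteinContinuation,
    analyticOnNhd_epsteinContinuation⟩

theorem epsteinExpression_epsteinContinuation {ℓ : ℝ} (hℓ : 0 < ℓ) {s : ℂ} (h1 : s ≠ 1)
    (hs : ∀ k : ℕ, s ≠ 1 / 2 - k) :
    epsteinExpression ℓ s (epsteinContinuation s) = chowlaSelbergTri ℓ s := by
  rw [epsteinContinuation, epsteinExpression_eq hℓ, epsteinRegular_add_epsteinPolar h1 hs,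
    chowlaSelbergTri_eq]

theorem meromorphic_riemannZeta_two_mul : Meromorphic fun s : ℂ => riemannZeta (2 * s) := by
  intro s
  have hpi : (π : ℂ) ≠ 0 := by exact_mod_cast pi_ne_zero
  have h1 : Differentiable ℂ fun s : ℂ => (π : ℂ) ^ s := differentiable_cpow_const hpi differentiable_id
  have h5 : Differentiable ℂ fun s : ℂ => (Complex.Gamma (s + 1))⁻¹ :=
    differentiable_inv_Gamma.comp (by fun_prop)
  have h6 : Differentiable ℂ fun s : ℂ => completedRiemannZeta₀ (2 * s) :=
    differentiable_completedZeta₀.comp (by fun_prop)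
  have h8 := (differentiable_inv_Gamma.analyticAt s).meromorphicAt
  have h4 : MeromorphicAt (fun s : ℂ => (s - 1 / 2)⁻¹) s :=
    ((analyticAt_id.sub analyticAt_const).meromorphicAt).inv
  have hc : MeromorphicAt (fun _ : ℂ => (1 / 2 : ℂ)) s := MeromorphicAt.const _ _
  have hmain := (h1.analyticAt s).meromorphicAt.mul
    ((((h6.analyticAt s).meromorphicAt.mul h8).sub
      (hc.mul (h5.analyticAt s).meromorphicAt)).add ((hc.mul h4).mul h8))
  refine hmain.congr ?_
  have hne : ∀ᶠ w in nhdsWithin s {s}ᶜ, w ≠ 1 / 2 := by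
    rcases eq_or_ne s (1 / 2) with h | h
    · rw [← h]
      exact self_mem_nhdsWithin
    · exact eventually_nhdsWithin_of_eventually_nhds (isOpen_ne.mem_nhds h)
  filter_upwards [hne] with w hw
  exact (riemannZeta_two_mul hw).symm

theorem isMeromorphicContinuation_epsteinExpression {ℓ : ℝ} (hℓ : 0 < ℓ) :
    IsMeromorphicContinuation (fun s => epsteinExpression ℓ s (epsteinTri s))
      (fun s => epsteinExpression ℓ s (epsteinContinuation s)) {1, 1 / 2} := by
  have hd : Differentiable ℂ fun s : ℂ => 1 / 6 * ((3 * ℓ / 4 : ℝ) : ℂ) ^ (2 * s) :=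
    (differentiable_cpow_const (by exact_mod_cast (by positivity)) (by fun_prop)).const_mul _
  have h6 : Differentiable ℂ fun s : ℂ => 6 / (π : ℂ) ^ (2 * s) := by
    simp_rw [div_eq_mul_one_div (6 : ℂ)]
    exact differentiable_one_div_pi_cpow.const_mul _
  refine ⟨fun s hs => by simp only [epsteinContinuation_eq hs], fun s => ?_, fun s hs => ?_⟩
  · exact (hd.analyticAt s).meromorphicAt.mul ((meromorphic_epsteinContinuation s).sub
      ((h6.analyticAt s).meromorphicAt.mul (meromorphic_riemannZeta_two_mul s)))
  · simp only [mem_compl_iff, mem_insert_iff, mem_singleton_iff, not_or] at hs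
    have hz : AnalyticAt ℂ (fun s : ℂ => riemannZeta (2 * s)) s := by
      have ho : IsOpen {w : ℂ | w ≠ 1 / 2} := isOpen_ne
      refine DifferentiableOn.analyticAt (s := {w : ℂ | w ≠ 1 / 2}) (fun w hw => ?_)
        (ho.mem_nhds hs.2)
      refine DifferentiableAt.differentiableWithinAt ?_
      refine (differentiableAt_riemannZeta (s := 2 * w) fun h => hw ?_).comp w (by fun_prop)
      linear_combination (1 / 2) * h
    exact (hd.analyticAt s).mul ((analyticOnNhd_epsteinContinuation s hs.1).sub
      ((h6.analyticAt s).mul hz))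

/-! ### Green's formula by slicing parallel to the sides. -/

/-- No first derivative of a solution is assumed to extend to the boundary. An integrable second
derivative bounds the first one, which suffices for the boundary term `f' g` to vanish in the limit
when `g` does. -/
theorem exists_forall_norm_le_of_hasDerivAt {b : ℝ} {f' f'' : ℝ → ℂ}
    (hf' : ∀ x ∈ Ioo 0 b, HasDerivAt f' (f'' x) x) (hint : IntegrableOn f'' (Ioo 0 b)) :
    ∃ C, ∀ x ∈ Ioo 0 b, ‖f' x‖ ≤ C := by
  rcases le_or_gt b 0 with hb | hb
  · exact ⟨0, fun x hx => absurd (hx.1.trans hx.2) (not_lt.mpr hb)⟩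
  have hc : b / 2 ∈ Ioo 0 b := ⟨by linarith, by linarith⟩
  refine ⟨‖f' (b / 2)‖ + ∫ t in Ioo 0 b, ‖f'' t‖, fun x hx => ?_⟩
  have hsub : uIcc (b / 2) x ⊆ Ioo 0 b := (ordConnected_Ioo.uIcc_subset hc hx)
  have hii : IntervalIntegrable f'' volume (b / 2) x :=
    (hint.mono_set hsub).intervalIntegrable
  have h := intervalIntegral.integral_eq_sub_of_hasDerivAt (fun t ht => hf' t (hsub ht)) hii
  have h2 : ‖∫ t in (b / 2)..x, f'' t‖ ≤ ∫ t in Ioo 0 b, ‖f'' t‖ := by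
    refine (intervalIntegral.norm_integral_le_integral_norm_uIoc).trans ?_
    exact setIntegral_mono_set hint.norm (ae_of_all _ fun t => norm_nonneg _)
      (uIoc_subset_uIcc.trans hsub).eventuallyLE
  have h3 : f' x = f' (b / 2) + ∫ t in (b / 2)..x, f'' t := by rw [h]; ring
  rw [h3]
  exact (norm_add_le _ _).trans (by gcongr)

/-- Green's formula on an interval, for functions vanishing at the end points. -/
theorem integral_second_deriv_mul_sub {b : ℝ} {f f' f'' g g' g'' : ℝ → ℂ}
    (hfc : Continuous f) (hf0 : f 0 = 0) (hfb : f b = 0)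
    (hf : ∀ x ∈ Ioo 0 b, HasDerivAt f (f' x) x) (hf' : ∀ x ∈ Ioo 0 b, HasDerivAt f' (f'' x) x)
    (hint : IntegrableOn f'' (Ioo 0 b)) (hg0 : g 0 = 0) (hgb : g b = 0)
    (hg : ∀ x, HasDerivAt g (g' x) x) (hg' : ∀ x, HasDerivAt g' (g'' x) x) (hg'' : Continuous g'') :
    ∫ x in Ioo 0 b, (f'' x * g x - f x * g'' x) = 0 := by
  rcases le_or_gt b 0 with hb | hb
  · rw [Ioo_eq_empty (not_lt.mpr hb), Measure.restrict_empty, integral_zero_measure]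
  obtain ⟨C, hC⟩ := exists_forall_norm_le_of_hasDerivAt hf' hint
  have hgc : Continuous g := continuous_iff_continuousAt.mpr fun x => (hg x).continuousAt
  have hgc' : Continuous g' := continuous_iff_continuousAt.mpr fun x => (hg' x).continuousAt
  have hlim : ∀ c, f c = 0 → g c = 0 → Tendsto (fun x => f' x * g x - f x * g' x)
      (nhdsWithin c (Ioo 0 b)) (nhds 0) := by
    intro c hfc0 hgc0
    have h1 : Tendsto (fun x => f x * g' x) (nhdsWithin c (Ioo 0 b)) (nhds 0) := by
      have := ((hfc.fun_mul hgc').tendsto c).mono_left (nhdsWithin_le_nhds (s := Ioo 0 b))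
      simpa [hfc0] using this
    have h2 : Tendsto (fun x => f' x * g x) (nhdsWithin c (Ioo 0 b)) (nhds 0) := by
      have h3 : Tendsto (fun x => C * ‖g x‖) (nhdsWithin c (Ioo 0 b)) (nhds 0) := by
        have := ((continuous_const.mul hgc.norm).tendsto (x := c) (f := fun x => C * ‖g x‖)).mono_left
          (nhdsWithin_le_nhds (s := Ioo 0 b))
        simpa [hgc0] using this
      refine squeeze_zero_norm' ?_ h3
      filter_upwards [self_mem_nhdsWithin] with x hx
      rw [norm_mul]
      gcongr
      exact hC x hx
    simpa using h2.sub h1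
  have hint2 : IntegrableOn (fun x => f'' x * g x - f x * g'' x) (Ioo 0 b) := by
    have h1 : IntegrableOn (fun x => f'' x * g x) (Icc 0 b) :=
      ((integrableOn_Icc_iff_integrableOn_Ioo).mpr hint).mul_continuousOn hgc.continuousOn isCompact_Icc
    have h2 : IntegrableOn (fun x => f x * g'' x) (Icc 0 b) :=
      (hfc.mul hg'').continuousOn.integrableOn_compact isCompact_Icc
    exact (h1.sub h2).mono_set Ioo_subset_Icc_self
  have h := intervalIntegral.integral_eq_sub_of_hasDerivAt_of_tendsto hb
    (f := fun x => f' x * g x - f x * g' x) (f' := fun x => f'' x * g x - f x * g'' x) (fa := 0) (fb := 0)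
    (fun x hx => by
      have := ((hf' x hx).fun_mul (hg x)).fun_sub ((hf x hx).fun_mul (hg' x))
      convert this using 1
      ring)
    ((intervalIntegrable_iff_integrableOn_Ioo_of_le hb.le).mpr hint2)
    (by have := hlim 0 hf0 hg0; rwa [nhdsWithin_Ioo_eq_nhdsGT hb] at this)
    (by have := hlim b hfb hgb; rwa [nhdsWithin_Ioo_eq_nhdsLT hb] at this)
  rw [intervalIntegral.integral_of_le hb.le, integral_Ioc_eq_integral_Ioo] at h
  rw [h, sub_zero]

/-- Uniqueness of Haar measure. The value of the constant never matters, because the integrals in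
question are shown to be zero. -/
theorem exists_map_volume_eq_smul (O : Plane) (L : (ℝ × ℝ) ≃L[ℝ] Plane) :
    ∃ c : NNReal, c ≠ 0 ∧ Measure.map (fun q => O + L q) volume = c • (volume : Measure Plane) := by
  have hc := Measure.isAddLeftInvariant_eq_smul (Measure.map L volume) (volume : Measure Plane)
  refine ⟨_, (Measure.addHaarScalarFactor_pos_of_isAddHaarMeasure (Measure.map L volume)
    (volume : Measure Plane)).ne', ?_⟩
  have : (fun q => O + L q) = (fun p => O + p) ∘ L := rfl
  rw [this, ← Measure.map_map (measurable_const_add O) L.continuous.measurable]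
  nth_rewrite 1 [hc]
  rw [Measure.map_smul, map_add_left_eq_self]

/-- The affine coordinates with origin `O` given by `L`. -/
noncomputable def affineChart (O : Plane) (L : (ℝ × ℝ) ≃L[ℝ] Plane) : (ℝ × ℝ) ≃ₜ Plane :=
  L.toHomeomorph.trans (Homeomorph.addLeft O)

theorem affineChart_apply (O : Plane) (L : (ℝ × ℝ) ≃L[ℝ] Plane) (q : ℝ × ℝ) :
    affineChart O L q = O + L q := rfl

theorem integrable_comp_affineChart (O : Plane) (L : (ℝ × ℝ) ≃L[ℝ] Plane) {G : Plane → ℂ}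
    (hG : Integrable G) : Integrable (fun q => G (O + L q)) := by
  obtain ⟨c, h0, hc⟩ := exists_map_volume_eq_smul O L
  have h : Integrable G (Measure.map (affineChart O L) volume) := by
    have : ⇑(affineChart O L) = fun q => O + L q := rfl
    rw [this, hc]
    exact hG.smul_measure_nnreal
  exact ((affineChart O L).measurableEmbedding.integrable_map_iff).mp h

theorem exists_integral_comp_affineChart (O : Plane) (L : (ℝ × ℝ) ≃L[ℝ] Plane) :
    ∃ c : ℝ, c ≠ 0 ∧ ∀ G : Plane → ℂ, ∫ q, G (O + L q) = c * ∫ p, G p := by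
  obtain ⟨c, h0, hc⟩ := exists_map_volume_eq_smul O L
  refine ⟨c, by exact_mod_cast h0, fun G => ?_⟩
  have h := (affineChart O L).measurableEmbedding.integral_map (μ := volume) G
  have : ⇑(affineChart O L) = fun q => O + L q := rfl
  rw [this, hc, integral_smul_nnreal_measure] at h
  exact h.symm

/-- The second derivative of `f` in the direction `v`. -/
noncomputable def dirSecond (f : Plane → ℂ) (v p : Plane) : ℂ := fderiv ℝ (fderiv ℝ f) p v v

theorem hasDerivAt_chart (O : Plane) (L : (ℝ × ℝ) ≃L[ℝ] Plane) (y x : ℝ) :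
    HasDerivAt (fun x : ℝ => O + L (x, y)) (L (1, 0)) x := by
  have h : HasDerivAt (fun x : ℝ => (x, y)) ((1, 0) : ℝ × ℝ) x :=
    (hasDerivAt_id x).prodMk (hasDerivAt_const x y)
  exact (L.hasFDerivAt.comp_hasDerivAt x h).const_add O

theorem ContDiffAt.hasDerivAt_comp_line {f : Plane → ℂ} {γ : ℝ → Plane} {v : Plane} {x : ℝ}
    (hf : ContDiffAt ℝ 2 f (γ x)) (hγ : HasDerivAt γ v x) :
    HasDerivAt (fun t => f (γ t)) (fderiv ℝ f (γ x) v) x ∧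
      HasDerivAt (fun t => fderiv ℝ f (γ t) v) (dirSecond f v (γ x)) x := by
  refine ⟨(hf.differentiableAt (by norm_num)).hasFDerivAt.comp_hasDerivAt x hγ, ?_⟩
  have h1 : ContDiffAt ℝ 1 (fderiv ℝ f) (γ x) := hf.fderiv_right (by norm_num)
  have h2 := (h1.differentiableAt (by norm_num)).hasFDerivAt.comp_hasDerivAt x hγ
  have h3 := h2.clm_apply (hasDerivAt_const x v)
  simpa [dirSecond] using h3

theorem continuous_dirSecond {f : Plane → ℂ} (hf : ContDiff ℝ 2 f) (v : Plane) :
    Continuous (dirSecond f v) := by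
  have h1 : ContDiff ℝ 1 (fderiv ℝ f) := hf.fderiv_right (by norm_num)
  have h2 : Continuous (fderiv ℝ (fderiv ℝ f)) := h1.continuous_fderiv (by norm_num)
  unfold dirSecond
  fun_prop

section Slices

variable {Ω : Opens Plane} {O : Plane} {L : (ℝ × ℝ) ≃L[ℝ] Plane}

theorem exists_isCompact_superset
    (hmem : ∀ x y, O + L (x, y) ∈ Ω ↔ 0 < x ∧ 0 < y ∧ x + y < 1) :
    ∃ K : Set Plane, IsCompact K ∧ (Ω : Set Plane) ⊆ K := by
  refine ⟨affineChart O L '' (Icc 0 1 ×ˢ Icc 0 1),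
    (isCompact_Icc.prod isCompact_Icc).image (affineChart O L).continuous, fun p hp => ?_⟩
  obtain ⟨⟨x, y⟩, rfl⟩ := (affineChart O L).surjective p
  have h := (hmem x y).mp hp
  exact ⟨(x, y), ⟨⟨h.1.le, by linarith⟩, ⟨h.2.1.le, by linarith⟩⟩, rfl⟩

theorem IsDirichletSolution.integrableOn_dirSecond {μ : ℝ} {u : Plane → ℂ}
    (hu : IsDirichletSolution Ω μ u) {K : Set Plane} (hK : IsCompact K) (hΩK : (Ω : Set Plane) ⊆ K)
    (v : Plane) : IntegrableOn (dirSecond u v) Ω := by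
  have : IsFiniteMeasure (volume.restrict (Ω : Set Plane)) :=
    isFiniteMeasure_restrict.mpr ((measure_mono hΩK).trans_lt hK.measure_lt_top).ne
  have h := (hu.memLp 2 le_rfl).integrable (by norm_num)
  have h2 := (ContinuousMultilinearMap.apply ℝ (fun _ : Fin 2 => Plane) ℂ ![v, v]).integrable_comp h
  refine h2.congr (ae_of_all _ fun p => ?_)
  simp [dirSecond, iteratedFDeriv_two_apply]

theorem IsDirichletSolution.integrableOn_green {μ : ℝ} {u φ : Plane → ℂ}
    (hu : IsDirichletSolution Ω μ u) {K : Set Plane} (hK : IsCompact K) (hΩK : (Ω : Set Plane) ⊆ K)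
    (hφ : ContDiff ℝ 2 φ) (v : Plane) :
    IntegrableOn (fun p => dirSecond u v p * φ p - u p * dirSecond φ v p) Ω := by
  obtain ⟨C, hC⟩ := hK.exists_bound_of_continuousOn hφ.continuous.continuousOn
  refine Integrable.sub ?_ ?_
  · refine (hu.integrableOn_dirSecond hK hΩK v).mul_bdd (c := C) hφ.continuous.aestronglyMeasurable ?_
    exact ae_restrict_of_forall_mem Ω.isOpen.measurableSet fun p hp => hC p (hΩK hp)
  · exact ((hu.continuous.mul (continuous_dirSecond hφ v)).continuousOn.integrableOn_compact hK).mono_set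
      hΩK

/-- Green's formula for the second derivative in the direction of a side of the triangle. -/
theorem IsDirichletSolution.integral_green_direction {μ : ℝ} {u φ : Plane → ℂ}
    (hu : IsDirichletSolution Ω μ u)
    (hmem : ∀ x y, O + L (x, y) ∈ Ω ↔ 0 < x ∧ 0 < y ∧ x + y < 1) (hφ : ContDiff ℝ 2 φ)
    (h0 : ∀ y, φ (O + L (0, y)) = 0) (h1 : ∀ y, φ (O + L (1 - y, y)) = 0) :
    ∫ p in (Ω : Set Plane), (dirSecond u (L (1, 0)) p * φ p - u p * dirSecond φ (L (1, 0)) p) = 0 := by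
  obtain ⟨K, hK, hΩK⟩ := exists_isCompact_superset hmem
  set E := L (1, 0) with hE
  have hΩm : MeasurableSet (Ω : Set Plane) := Ω.isOpen.measurableSet
  have hD := integrable_comp_affineChart O L
    ((integrable_indicator_iff hΩm).mpr (hu.integrableOn_dirSecond hK hΩK E))
  have hF := integrable_comp_affineChart O L
    ((integrable_indicator_iff hΩm).mpr (hu.integrableOn_green hK hΩK hφ E))
  obtain ⟨c, hc, hint⟩ := exists_integral_comp_affineChart O L
  rw [← integral_indicator hΩm]
  refine (mul_eq_zero_iff_left (by exact_mod_cast hc : (c : ℂ) ≠ 0)).mp ?_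
  rw [← hint, Measure.volume_eq_prod, integral_prod_symm _ hF]
  refine integral_eq_zero_of_ae ?_
  -- By Fubini the `H²` hypothesis makes the second derivative integrable on almost every line
  -- parallel to the side, and the one-dimensional formula applies there.
  filter_upwards [hD.prod_left_ae] with y hy
  rw [Pi.zero_apply]
  rcases le_or_gt y 0 with hy0 | hy0
  · refine integral_eq_zero_of_ae (ae_of_all _ fun x => ?_)
    refine indicator_of_notMem (fun h => ?_) _
    exact absurd ((hmem x y).mp h).2.1 (not_lt.mpr hy0)
  have hiff : ∀ x, O + L (x, y) ∈ (Ω : Set Plane) ↔ x ∈ Ioo 0 (1 - y) := by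
    intro x
    refine (hmem x y).trans ⟨fun h => ⟨h.1, by linarith⟩, fun h => ⟨h.1, hy0, ?_⟩⟩
    have := h.2
    linarith
  have hind : ∀ G : Plane → ℂ, (fun x => (Ω : Set Plane).indicator G (O + L (x, y))) =
      (Ioo 0 (1 - y)).indicator fun x => G (O + L (x, y)) := by
    intro G
    funext x
    by_cases hx : x ∈ Ioo 0 (1 - y)
    · rw [indicator_of_mem hx, indicator_of_mem ((hiff x).mpr hx)]
    · rw [indicator_of_notMem hx, indicator_of_notMem fun h => hx ((hiff x).mp h)]
  rw [hind] at hy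
  rw [hind, integral_indicator measurableSet_Ioo]
  have hγ : ∀ x, HasDerivAt (fun x : ℝ => O + L (x, y)) E x := hasDerivAt_chart O L y
  have hγc : Continuous fun x : ℝ => O + L (x, y) :=
    continuous_iff_continuousAt.mpr fun x => (hγ x).continuousAt
  refine integral_second_deriv_mul_sub (f := fun x => u (O + L (x, y)))
    (f' := fun x => fderiv ℝ u (O + L (x, y)) E) (f'' := fun x => dirSecond u E (O + L (x, y)))
    (g := fun x => φ (O + L (x, y))) (g' := fun x => fderiv ℝ φ (O + L (x, y)) E)
    (g'' := fun x => dirSecond φ E (O + L (x, y))) (hu.continuous.comp hγc) ?_ ?_ ?_ ?_ ?_ (h0 y) (h1 y)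
    ?_ ?_ ((continuous_dirSecond hφ E).comp hγc)
  · exact hu.eq_zero _ fun h => absurd ((hmem 0 y).mp h).1 (lt_irrefl 0)
  · exact hu.eq_zero _ fun h => absurd ((hmem (1 - y) y).mp h).2.2 (by norm_num)
  · exact fun x hx => ((hu.contDiffAt _ ((hiff x).mpr hx)).hasDerivAt_comp_line (hγ x)).1
  · exact fun x hx => ((hu.contDiffAt _ ((hiff x).mpr hx)).hasDerivAt_comp_line (hγ x)).2
  · exact (integrable_indicator_iff measurableSet_Ioo).mp hy
  · exact fun x => (hφ.contDiffAt.hasDerivAt_comp_line (hγ x)).1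
  · exact fun x => (hφ.contDiffAt.hasDerivAt_comp_line (hγ x)).2

end Slices

/-! ### Affine coordinates adapted to the triangle. -/

/-- The linear automorphism of `ℝ × ℝ` with matrix `!![a, b; c, d]`. -/
noncomputable def matrixEquiv (a b c d : ℝ) (h : a * d - b * c ≠ 0) : (ℝ × ℝ) ≃L[ℝ] (ℝ × ℝ) :=
  LinearEquiv.toContinuousLinearEquiv
    { toFun := fun q => (a * q.1 + b * q.2, c * q.1 + d * q.2)
      invFun := fun q => ((d * q.1 - b * q.2) / (a * d - b * c), (a * q.2 - c * q.1) / (a * d - b * c))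
      map_add' := fun p q => by ext <;> simp <;> ring
      map_smul' := fun r q => by ext <;> simp <;> ring
      left_inv := fun q => by
        ext
        · dsimp only
          rw [div_eq_iff h]; ring
        · dsimp only
          rw [div_eq_iff h]; ring
      right_inv := fun q => by
        ext
        · dsimp only
          rw [← mul_div_assoc, ← mul_div_assoc, ← add_div, div_eq_iff h]; ring
        · dsimp only
          rw [← mul_div_assoc, ← mul_div_assoc, ← add_div, div_eq_iff h]; ring }

@[simp]
theorem matrixEquiv_apply (a b c d : ℝ) (h : a * d - b * c ≠ 0) (x y : ℝ) :
    matrixEquiv a b c d h (x, y) = (a * x + b * y, c * x + d * y) := rfl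

/-- The affine coordinates `A + C (s, t)` of the plane are adapted to an equilateral triangle `Ω`
of side `ℓ`: the sides of `Ω` lie on the lines `t = 2 s`, `s = 2 t` and `s + t = 1`. -/
structure IsTriangleChart (ℓ : ℝ) (Ω : Opens Plane) (A : Plane) (C : (ℝ × ℝ) ≃L[ℝ] Plane) : Prop where
  mem_iff : ∀ s t, A + C (s, t) ∈ Ω ↔ 0 < 2 * s - t ∧ 0 < 2 * t - s ∧ s + t < 1
  laplacian_eq : ∀ (f : Plane → ℂ) (p : Plane), Δ f p = ((2 / (3 * ℓ ^ 2) : ℝ) : ℂ) *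
    (dirSecond f (C (2 / 3, 1 / 3)) p + dirSecond f (C (1 / 3, 2 / 3)) p
      + dirSecond f (C (-1 / 3, 1 / 3)) p)

/-- The two mixed terms are kept apart, so no symmetry of the second derivative is needed; in the
sum over the three side directions their coefficients cancel. -/
theorem dirSecond_add_smul (f : Plane → ℂ) (v w p : Plane) (a b : ℝ) :
    dirSecond f (a • v + b • w) p = (a : ℂ) ^ 2 * dirSecond f v p
      + a * b * (fderiv ℝ (fderiv ℝ f) p v w + fderiv ℝ (fderiv ℝ f) p w v)
      + (b : ℂ) ^ 2 * dirSecond f w p := by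
  simp only [dirSecond, map_add, map_smul, add_apply, smul_apply, Complex.real_smul]
  ring

theorem laplacian_eq_dirSecond_add (b : OrthonormalBasis (Fin 2) ℝ Plane) (f : Plane → ℂ) (p : Plane) :
    Δ f p = dirSecond f (b 0) p + dirSecond f (b 1) p := by
  rw [InnerProductSpace.laplacian_eq_iteratedFDeriv_orthonormalBasis f b]
  simp [Fin.sum_univ_two, iteratedFDeriv_two_apply, dirSecond]

theorem IsEquilateralTriangle.exists_chart {ℓ : ℝ} (hℓ : 0 < ℓ) {Ω : Opens Plane}
    (hΩ : IsEquilateralTriangle ℓ Ω) : ∃ A C, IsTriangleChart ℓ Ω A C := by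
  obtain ⟨e, he⟩ := hΩ
  have h3 : (0 : ℝ) < √3 := by positivity
  have h33 : √3 * √3 = 3 := Real.mul_self_sqrt (by norm_num)
  -- The columns are normal to two sides and have length `√3 ℓ`, twice the height: they generate the
  -- translations obtained by composing reflections in parallel mirrors. The vertices get
  -- coordinates `(0, 0)`, `(2 / 3, 1 / 3)`, `(1 / 3, 2 / 3)`.
  let C₀ : (ℝ × ℝ) ≃L[ℝ] Plane :=
    ((matrixEquiv (3 / 2 * ℓ) 0 (-(√3 / 2 * ℓ)) (√3 * ℓ)
      (by have : 0 < 3 / 2 * ℓ * (√3 * ℓ) := by positivity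
          simpa using this.ne')).trans
      (ContinuousLinearEquiv.finTwoArrow ℝ ℝ).symm).trans (EuclideanSpace.equiv (Fin 2) ℝ).symm
  have hC0 : ∀ s t, C₀ (s, t) 0 = 3 / 2 * ℓ * s := fun s t => by simp [C₀]
  have hC1 : ∀ s t, C₀ (s, t) 1 = -(√3 / 2 * ℓ) * s + √3 * ℓ * t := fun s t => by simp [C₀]
  let b := (EuclideanSpace.basisFun (Fin 2) ℝ).map e.linearIsometryEquiv
  have hb : ∀ x : Plane, e.linearIsometryEquiv x = x 0 • b 0 + x 1 • b 1 := by
    intro x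
    have hx : x = x 0 • EuclideanSpace.basisFun (Fin 2) ℝ 0 + x 1 • EuclideanSpace.basisFun (Fin 2) ℝ 1 := by
      ext i
      fin_cases i <;> simp
    conv_lhs => rw [hx]
    simp only [map_add, map_smul]
    simp [b]
  refine ⟨e 0, C₀.trans e.linearIsometryEquiv.toContinuousLinearEquiv, ⟨fun s t => ?_, fun f p => ?_⟩⟩
  · have h1 : e 0 + (C₀.trans e.linearIsometryEquiv.toContinuousLinearEquiv) (s, t) = e (C₀ (s, t)) := by
      have := e.map_vadd 0 (C₀ (s, t))
      simp only [vadd_eq_add, add_zero] at this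
      rw [this, add_comm]
      rfl
    have h2 : e (C₀ (s, t)) ∈ Ω ↔ C₀ (s, t) ∈ standardTriangle ℓ := by
      rw [← SetLike.mem_coe, he]
      exact e.injective.mem_set_image
    rw [h1, h2, standardTriangle, Set.mem_ofPred_eq, hC0, hC1]
    have hpos : 0 < √3 * ℓ := by positivity
    have g1 : 0 < -(√3 / 2 * ℓ) * s + √3 * ℓ * t ↔ 0 < 2 * t - s := by
      rw [show -(√3 / 2 * ℓ) * s + √3 * ℓ * t = √3 * ℓ / 2 * (2 * t - s) by ring,
        mul_pos_iff_of_pos_left (half_pos hpos)]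
    have g2 : -(√3 / 2 * ℓ) * s + √3 * ℓ * t < √3 * (3 / 2 * ℓ * s) ↔ 0 < 2 * s - t := by
      rw [← sub_pos, show √3 * (3 / 2 * ℓ * s) - (-(√3 / 2 * ℓ) * s + √3 * ℓ * t) =
        √3 * ℓ * (2 * s - t) by ring, mul_pos_iff_of_pos_left hpos]
    have g3 : -(√3 / 2 * ℓ) * s + √3 * ℓ * t < √3 * (ℓ - 3 / 2 * ℓ * s) ↔ s + t < 1 := by
      rw [← sub_pos, show √3 * (ℓ - 3 / 2 * ℓ * s) - (-(√3 / 2 * ℓ) * s + √3 * ℓ * t) =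
        √3 * ℓ * (1 - (s + t)) by ring, mul_pos_iff_of_pos_left hpos, sub_pos]
    rw [g1, g2, g3]
    tauto
  · have hE : ∀ s t, (C₀.trans e.linearIsometryEquiv.toContinuousLinearEquiv) (s, t) =
        (3 / 2 * ℓ * s) • b 0 + (-(√3 / 2 * ℓ) * s + √3 * ℓ * t) • b 1 := by
      intro s t
      rw [← hC0 s t, ← hC1 s t, ← hb]
      rfl
    rw [hE, hE, hE, dirSecond_add_smul, dirSecond_add_smul, dirSecond_add_smul,
      laplacian_eq_dirSecond_add b]
    have hℓ' : (ℓ : ℂ) ≠ 0 := by exact_mod_cast hℓ.ne'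
    have h33' : ((√3 : ℝ) : ℂ) ^ 2 = 3 := by
      rw [sq]
      exact_mod_cast h33
    push_cast
    field_simp
    ring_nf
    rw [h33']
    ring

/-! ### Lamé functions and their orthogonality to solutions with another eigenvalue. -/

/-- The Dirichlet eigenvalues of an equilateral triangle of side `ℓ`. -/
noncomputable def lameEigenvalue (ℓ : ℝ) (p : ℤ × ℤ) : ℝ := 16 * π ^ 2 / (9 * ℓ ^ 2) * hexForm p

/-- The character `(s, t) ↦ exp (2 π i (m s + n t))` of the plane. -/
noncomputable def planeWave (m n : ℤ) (q : ℝ × ℝ) : ℂ :=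
  Complex.exp (2 * π * Complex.I * (m * q.1 + n * q.2))

/-- Lamé's trigonometric function: a planar character, antisymmetrised over the symmetric group. -/
noncomputable def lame (m n : ℤ) (q : ℝ × ℝ) : ℂ :=
  planeWave m n q - planeWave (-m) (m + n) q - planeWave (m + n) (-n) q - planeWave (-n) (-m) q
    + planeWave (-m - n) m q + planeWave n (-m - n) q

theorem planeWave_congr {m n m' n' : ℤ} {q q' : ℝ × ℝ} (k : ℤ)
    (h : m * q.1 + n * q.2 = m' * q'.1 + n' * q'.2 + k) : planeWave m n q = planeWave m' n' q' := by
  have h' : (m * q.1 + n * q.2 : ℂ) = m' * q'.1 + n' * q'.2 + k := by exact_mod_cast h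
  have hk : Complex.exp (2 * π * Complex.I * k) = 1 := Complex.exp_eq_one_iff.mpr ⟨k, by ring⟩
  rw [planeWave, planeWave, h', mul_add _ _ (k : ℂ), Complex.exp_add, hk, mul_one]

theorem contDiff_planeWave (m n : ℤ) {r : WithTop ℕ∞} : ContDiff ℝ r (planeWave m n) := by
  have h1 : ContDiff ℝ r fun q : ℝ × ℝ => (q.1 : ℂ) := Complex.ofRealCLM.contDiff.comp contDiff_fst
  have h2 : ContDiff ℝ r fun q : ℝ × ℝ => (q.2 : ℂ) := Complex.ofRealCLM.contDiff.comp contDiff_snd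
  unfold planeWave
  fun_prop

theorem contDiff_lame (m n : ℤ) {r : WithTop ℕ∞} : ContDiff ℝ r (lame m n) :=
  (((((contDiff_planeWave _ _).sub (contDiff_planeWave _ _)).sub (contDiff_planeWave _ _)).sub
    (contDiff_planeWave _ _)).add (contDiff_planeWave _ _)).add (contDiff_planeWave _ _)

/-- The reflection in this line pairs the six characters into three pairs with opposite signs, and
the members of a pair agree on the line. The same holds for the other two sides. -/
theorem lame_eq_zero_left (m n : ℤ) {q : ℝ × ℝ} (h : q.2 = 2 * q.1) : lame m n q = 0 := by
  have h1 : planeWave (-m) (m + n) q = planeWave m n q :=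
    planeWave_congr 0 (by push_cast; rw [h]; ring)
  have h2 : planeWave (-m - n) m q = planeWave (m + n) (-n) q :=
    planeWave_congr 0 (by push_cast; rw [h]; ring)
  have h3 : planeWave n (-m - n) q = planeWave (-n) (-m) q :=
    planeWave_congr 0 (by push_cast; rw [h]; ring)
  rw [lame, h1, h2, h3]
  ring

theorem lame_eq_zero_right (m n : ℤ) {q : ℝ × ℝ} (h : q.1 = 2 * q.2) : lame m n q = 0 := by
  have h1 : planeWave (m + n) (-n) q = planeWave m n q :=
    planeWave_congr 0 (by push_cast; rw [h]; ring)
  have h2 : planeWave (-m - n) m q = planeWave (-n) (-m) q :=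
    planeWave_congr 0 (by push_cast; rw [h]; ring)
  have h3 : planeWave n (-m - n) q = planeWave (-m) (m + n) q :=
    planeWave_congr 0 (by push_cast; rw [h]; ring)
  rw [lame, h1, h2, h3]
  ring

theorem lame_eq_zero_of_add_eq_one (m n : ℤ) {q : ℝ × ℝ} (h : q.1 + q.2 = 1) : lame m n q = 0 := by
  have h' : q.1 = 1 - q.2 := by linarith
  -- This mirror misses the origin, so paired phases agree only modulo integers, which the
  -- characters do not see.
  have h1 : planeWave (-n) (-m) q = planeWave m n q :=
    planeWave_congr (-m - n) (by push_cast; rw [h']; ring)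
  have h2 : planeWave (-m - n) m q = planeWave (-m) (m + n) q :=
    planeWave_congr (-n) (by push_cast; rw [h']; ring)
  have h3 : planeWave n (-m - n) q = planeWave (m + n) (-n) q :=
    planeWave_congr (-m) (by push_cast; rw [h']; ring)
  rw [lame, h1, h2, h3]
  ring

section Chart

variable {ℓ : ℝ} {Ω : Opens Plane} {A : Plane} {C : (ℝ × ℝ) ≃L[ℝ] Plane}

theorem contDiff_comp_chart {f : ℝ × ℝ → ℂ} {r : WithTop ℕ∞} (hf : ContDiff ℝ r f) (A : Plane)
    (C : (ℝ × ℝ) ≃L[ℝ] Plane) : ContDiff ℝ r fun p => f (C.symm (p - A)) :=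
  hf.comp (C.symm.contDiff.comp (contDiff_id.sub contDiff_const))

theorem dirSecond_planeWave (m n : ℤ) (A : Plane) (C : (ℝ × ℝ) ≃L[ℝ] Plane) (v : ℝ × ℝ) (p : Plane) :
    dirSecond (fun p => planeWave m n (C.symm (p - A))) (C v) p =
      (2 * π * Complex.I * (m * v.1 + n * v.2)) ^ 2 * planeWave m n (C.symm (p - A)) := by
  set f : Plane → ℂ := fun p => planeWave m n (C.symm (p - A)) with hf
  set c : ℂ := 2 * π * Complex.I * (m * v.1 + n * v.2) with hc
  have hfc : ContDiff ℝ 2 f := contDiff_comp_chart (contDiff_planeWave m n) A C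
  have hγ : ∀ (p : Plane) (x : ℝ), HasDerivAt (fun x : ℝ => p + x • C v) (C v) x := fun p x => by
    simpa using ((hasDerivAt_id x).smul_const (C v)).const_add p
  have hline : ∀ (p : Plane) (x : ℝ), f (p + x • C v) = f p * Complex.exp (c * x) := by
    intro p x
    have h1 : C.symm (p + x • C v - A) = C.symm (p - A) + x • v := by
      rw [add_sub_right_comm, map_add, map_smul, C.symm_apply_apply]
    simp only [hf, h1, planeWave, hc, ← Complex.exp_add]
    congr 1
    simp
    ring
  have hder : ∀ (p : Plane), HasDerivAt (fun x : ℝ => f (p + x • C v)) (c * f p) 0 := by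
    intro p
    have h1 : HasDerivAt (fun x : ℝ => Complex.exp (c * x)) (Complex.exp (c * (0 : ℝ)) * (c * 1)) 0 :=
      ((Complex.ofRealCLM.hasDerivAt (x := (0 : ℝ))).const_mul c).cexp
    have h2 := h1.const_mul (f p)
    simp only [hline]
    convert! h2 using 1
    simp
    ring
  have hfd : ∀ p, fderiv ℝ f p (C v) = c * f p := by
    intro p
    have h1 := (ContDiffAt.hasDerivAt_comp_line (f := f) (x := 0) hfc.contDiffAt (hγ p 0)).1
    simpa using h1.unique (hder p)
  have h2 := (ContDiffAt.hasDerivAt_comp_line (f := f) (x := 0) hfc.contDiffAt (hγ p 0)).2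
  simp only [hfd] at h2
  have h3 := h2.unique ((hder p).const_mul c)
  rw [zero_smul, add_zero] at h3
  rw [h3]
  ring

theorem IsTriangleChart.laplacian_planeWave (hC : IsTriangleChart ℓ Ω A C) (m n : ℤ) (p : Plane) :
    Δ (fun p => planeWave m n (C.symm (p - A))) p =
      -(lameEigenvalue ℓ (m, n) : ℂ) * planeWave m n (C.symm (p - A)) := by
  rw [hC.laplacian_eq, dirSecond_planeWave, dirSecond_planeWave, dirSecond_planeWave,
    lameEigenvalue, hexForm]
  push_cast
  simp only [mul_pow, Complex.I_sq]
  ring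

/-- The six frequencies form an orbit of the finite Weyl group, which preserves `hexForm`, so all
six characters share one eigenvalue. -/
theorem IsTriangleChart.laplacian_lame (hC : IsTriangleChart ℓ Ω A C) (m n : ℤ) (p : Plane) :
    Δ (fun p => lame m n (C.symm (p - A))) p =
      -(lameEigenvalue ℓ (m, n) : ℂ) * lame m n (C.symm (p - A)) := by
  set c : ℂ := -(lameEigenvalue ℓ (m, n) : ℂ) with hc
  have hw : ∀ m' n' : ℤ, hexForm (m', n') = hexForm (m, n) →
      ContDiffAt ℝ 2 (fun p => planeWave m' n' (C.symm (p - A))) p ∧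
      Δ (fun p => planeWave m' n' (C.symm (p - A))) p = c * planeWave m' n' (C.symm (p - A)) :=
    fun m' n' h => ⟨(contDiff_comp_chart (contDiff_planeWave m' n') A C).contDiffAt, by
      rw [hC.laplacian_planeWave, hc, lameEigenvalue, lameEigenvalue, h]⟩
  have hadd : ∀ {f g : Plane → ℂ}, ContDiffAt ℝ 2 f p ∧ Δ f p = c * f p →
      ContDiffAt ℝ 2 g p ∧ Δ g p = c * g p → ContDiffAt ℝ 2 (f + g) p ∧ Δ (f + g) p = c * (f + g) p :=
    fun hf hg => ⟨hf.1.add hg.1, by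
      rw [hf.1.laplacian_add hg.1, hf.2, hg.2, Pi.add_apply, mul_add]⟩
  have hsub : ∀ {f g : Plane → ℂ}, ContDiffAt ℝ 2 f p ∧ Δ f p = c * f p →
      ContDiffAt ℝ 2 g p ∧ Δ g p = c * g p → ContDiffAt ℝ 2 (f - g) p ∧ Δ (f - g) p = c * (f - g) p :=
    fun hf hg => ⟨hf.1.sub hg.1, by
      rw [hf.1.laplacian_sub hg.1, hf.2, hg.2, Pi.sub_apply, mul_sub]⟩
  exact (hadd (hadd (hsub (hsub (hsub (hw m n rfl)
    (hw (-m) (m + n) (by simp only [hexForm]; push_cast; ring)))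
    (hw (m + n) (-n) (by simp only [hexForm]; push_cast; ring)))
    (hw (-n) (-m) (by simp only [hexForm]; push_cast; ring)))
    (hw (-m - n) m (by simp only [hexForm]; push_cast; ring)))
    (hw n (-m - n) (by simp only [hexForm]; push_cast; ring))).2

theorem IsTriangleChart.exists_isCompact_superset (hC : IsTriangleChart ℓ Ω A C) :
    ∃ K : Set Plane, IsCompact K ∧ (Ω : Set Plane) ⊆ K := by
  refine ⟨affineChart A C '' (Icc 0 1 ×ˢ Icc 0 1),
    (isCompact_Icc.prod isCompact_Icc).image (affineChart A C).continuous, fun p hp => ?_⟩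
  obtain ⟨⟨s, t⟩, rfl⟩ := (affineChart A C).surjective p
  have h := (hC.mem_iff s t).mp hp
  exact ⟨(s, t), ⟨⟨by linarith, by linarith⟩, ⟨by linarith, by linarith⟩⟩, rfl⟩

/-- Green's formula in a triangle, for a Dirichlet solution and a Lamé function. -/
theorem IsTriangleChart.integral_mul_lame_eq_zero (hC : IsTriangleChart ℓ Ω A C) {μ : ℝ}
    {u : Plane → ℂ} (hu : IsDirichletSolution Ω μ u) {m n : ℤ} (hμ : lameEigenvalue ℓ (m, n) ≠ μ) :
    ∫ p in (Ω : Set Plane), u p * lame m n (C.symm (p - A)) = 0 := by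
  set φ : Plane → ℂ := fun p => lame m n (C.symm (p - A)) with hφ
  have hφc : ContDiff ℝ 2 φ := contDiff_comp_chart (contDiff_lame m n) A C
  have hφA : ∀ q, φ (A + C q) = lame m n q := fun q => by simp [hφ]
  obtain ⟨K, hK, hΩK⟩ := hC.exists_isCompact_superset
  -- Each of the three coordinate systems takes a different side of the triangle as first axis, with
  -- a vertex as origin; the three Green identities add up to the one for the Laplacian.
  let M₁ := matrixEquiv (2 / 3) (1 / 3) (1 / 3) (2 / 3) (by norm_num)
  let M₂ := matrixEquiv (1 / 3) (2 / 3) (2 / 3) (1 / 3) (by norm_num)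
  let M₃ := matrixEquiv (-1 / 3) (-2 / 3) (1 / 3) (-1 / 3) (by norm_num)
  have h1 := hu.integral_green_direction (O := A) (L := M₁.trans C) (φ := φ) (fun x y => by
      rw [ContinuousLinearEquiv.trans_apply, matrixEquiv_apply, hC.mem_iff]
      constructor <;> intro h <;> refine ⟨?_, ?_, ?_⟩ <;> linarith [h.1, h.2.1, h.2.2]) hφc
    (fun y => by
      rw [ContinuousLinearEquiv.trans_apply, matrixEquiv_apply, hφA]
      exact lame_eq_zero_left m n (by dsimp only; ring))
    (fun y => by
      rw [ContinuousLinearEquiv.trans_apply, matrixEquiv_apply, hφA]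
      exact lame_eq_zero_of_add_eq_one m n (by dsimp only; ring))
  have h2 := hu.integral_green_direction (O := A) (L := M₂.trans C) (φ := φ) (fun x y => by
      rw [ContinuousLinearEquiv.trans_apply, matrixEquiv_apply, hC.mem_iff]
      constructor <;> intro h <;> refine ⟨?_, ?_, ?_⟩ <;> linarith [h.1, h.2.1, h.2.2]) hφc
    (fun y => by
      rw [ContinuousLinearEquiv.trans_apply, matrixEquiv_apply, hφA]
      exact lame_eq_zero_right m n (by dsimp only; ring))
    (fun y => by
      rw [ContinuousLinearEquiv.trans_apply, matrixEquiv_apply, hφA]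
      exact lame_eq_zero_of_add_eq_one m n (by dsimp only; ring))
  have hO : ∀ x y : ℝ, A + C (2 / 3, 1 / 3) + (M₃.trans C) (x, y) =
      A + C (2 / 3 + (-1 / 3 * x + -2 / 3 * y), 1 / 3 + (1 / 3 * x + -1 / 3 * y)) := fun x y => by
    rw [ContinuousLinearEquiv.trans_apply, matrixEquiv_apply, add_assoc, ← map_add, Prod.mk_add_mk]
  have h3 := hu.integral_green_direction (O := A + C (2 / 3, 1 / 3)) (L := M₃.trans C) (φ := φ)
    (fun x y => by
      rw [hO, hC.mem_iff]
      constructor <;> intro h <;> refine ⟨?_, ?_, ?_⟩ <;> linarith [h.1, h.2.1, h.2.2]) hφc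
    (fun y => by
      rw [hO, hφA]
      exact lame_eq_zero_right m n (by dsimp only; ring))
    (fun y => by
      rw [hO, hφA]
      exact lame_eq_zero_left m n (by dsimp only; ring))
  have e1 : (M₁.trans C) (1, 0) = C (2 / 3, 1 / 3) := by simp [M₁]
  have e2 : (M₂.trans C) (1, 0) = C (1 / 3, 2 / 3) := by simp [M₂]
  have e3 : (M₃.trans C) (1, 0) = C (-1 / 3, 1 / 3) := by simp [M₃]
  rw [e1] at h1
  rw [e2] at h2
  rw [e3] at h3
  have hi := fun v => hu.integrableOn_green hK hΩK hφc v
  have hsum : ∫ p in (Ω : Set Plane), ((lameEigenvalue ℓ (m, n) : ℂ) - μ) * (u p * φ p) = 0 := by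
    calc ∫ p in (Ω : Set Plane), ((lameEigenvalue ℓ (m, n) : ℂ) - μ) * (u p * φ p)
        = ∫ p in (Ω : Set Plane), ((2 / (3 * ℓ ^ 2) : ℝ) : ℂ) *
          ((dirSecond u (C (2 / 3, 1 / 3)) p * φ p - u p * dirSecond φ (C (2 / 3, 1 / 3)) p) +
          (dirSecond u (C (1 / 3, 2 / 3)) p * φ p - u p * dirSecond φ (C (1 / 3, 2 / 3)) p) +
          (dirSecond u (C (-1 / 3, 1 / 3)) p * φ p - u p * dirSecond φ (C (-1 / 3, 1 / 3)) p)) := by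
          refine setIntegral_congr_fun Ω.isOpen.measurableSet fun p hp => ?_
          have hu1 := hu.equation p hp
          have hφ1 := hC.laplacian_lame m n p
          rw [hC.laplacian_eq] at hu1 hφ1
          linear_combination -φ p * hu1 + u p * hφ1
      _ = 0 := by
          rw [integral_const_mul, integral_add ((hi _).fun_add (hi _)) (hi _), integral_add (hi _) (hi _),
            h1, h2, h3]
          simp
  rw [integral_const_mul] at hsum
  refine (mul_eq_zero.mp hsum).resolve_left (sub_ne_zero.mpr ?_)
  exact_mod_cast hμ

end Chart

/-! ### Completeness of the Lamé functions. -/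

theorem integral_comp_matrixEquiv {a b c d : ℝ} (h : a * d - b * c ≠ 0) (h1 : |a * d - b * c| = 1)
    (F : ℝ × ℝ → ℂ) : ∫ q, F (matrixEquiv a b c d h q) = ∫ q, F q := by
  have hL : ((matrixEquiv a b c d h : (ℝ × ℝ) ≃L[ℝ] (ℝ × ℝ)) : (ℝ × ℝ) →ₗ[ℝ] (ℝ × ℝ)) =
      Matrix.toLin (Module.Basis.finTwoProd ℝ) (Module.Basis.finTwoProd ℝ) !![a, b; c, d] := by
    rw [Matrix.toLin_finTwoProd]
    ext <;> simp
  have hdet : LinearMap.det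
      ((matrixEquiv a b c d h : (ℝ × ℝ) ≃L[ℝ] (ℝ × ℝ)) : (ℝ × ℝ) →ₗ[ℝ] (ℝ × ℝ)) = a * d - b * c := by
    rw [hL, LinearMap.det_toLin, Matrix.det_fin_two_of]
  have hmap := Measure.map_linearMap_addHaar_eq_smul_addHaar (μ := (volume : Measure (ℝ × ℝ)))
    (hdet.trans_ne h)
  rw [hdet, abs_inv, h1, inv_one, ENNReal.ofReal_one, one_smul] at hmap
  have hmp : MeasurePreserving (matrixEquiv a b c d h).toHomeomorph volume volume :=
    ⟨(matrixEquiv a b c d h).continuous.measurable, hmap⟩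
  exact hmp.integral_comp (matrixEquiv a b c d h).toHomeomorph.measurableEmbedding F

/-- A continuous function with compact support whose Fourier transform vanishes at the integers has
vanishing periodisation. -/
theorem tsum_add_intCast_eq_zero {f : ℝ → ℂ} (hf : Continuous f) (hc : HasCompactSupport f)
    (h : ∀ n : ℤ, ∫ x, f x * Complex.exp (2 * π * Complex.I * (n * x)) = 0) (x : ℝ) :
    ∑' n : ℤ, f (x + n) = 0 := by
  have hF : ∀ n : ℤ, FourierTransform.fourier f (n : ℝ) = 0 := by
    intro n
    rw [Real.fourier_real_eq_integral_exp_smul, ← h (-n)]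
    refine integral_congr_ae (ae_of_all _ fun v => ?_)
    simp only [smul_eq_mul]
    rw [mul_comm]
    congr 2
    push_cast
    ring
  have hO : f =O[cocompact ℝ] fun x : ℝ => |x| ^ (-2 : ℝ) := by
    refine EventuallyEq.trans_isBigO ?_ (isBigO_zero _ _)
    filter_upwards [hc.compl_mem_cocompact] with y hy
    exact image_eq_zero_of_notMem_tsupport hy
  rw [Real.tsum_eq_tsum_fourier_of_rpow_decay_of_summable hf (by norm_num : (1 : ℝ) < 2) hO
    (by simpa only [hF] using summable_zero)]
  simp only [hF, zero_mul, tsum_zero]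

/-- Poisson summation one variable at a time: first in `t` for each integer Fourier mode of `f` in
`s`, then in `s` for the function already periodised in `t`. Compact support makes the inner sums
finite. -/
theorem tsum_add_intCast_prod_eq_zero {f : ℝ × ℝ → ℂ} (hf : Continuous f) (hc : HasCompactSupport f)
    (h : ∀ m n : ℤ, ∫ q, f q * planeWave m n q = 0) (s t : ℝ) :
    ∑' k : ℤ, ∑' l : ℤ, f (s + k, t + l) = 0 := by
  obtain ⟨R, hR⟩ := hc.isCompact.isBounded.subset_closedBall 0
  have hf0 : ∀ s t, f (s, t) ≠ 0 → s ∈ Icc (-R) R ∧ t ∈ Icc (-R) R := by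
    intro s t hst
    have := hR (subset_tsupport f hst)
    rw [mem_closedBall_zero_iff, Prod.norm_mk, max_le_iff, Real.norm_eq_abs, Real.norm_eq_abs,
      abs_le, abs_le] at this
    exact this
  have hw : ∀ (m : ℤ), Continuous fun s : ℝ => Complex.exp (2 * π * Complex.I * (m * s)) := by
    intro m
    fun_prop
  have hcs : ∀ t, HasCompactSupport fun s => f (s, t) := fun t =>
    HasCompactSupport.of_support_subset_isCompact isCompact_Icc fun s hs => (hf0 s t hs).1
  have hint : ∀ (t : ℝ) (m : ℤ),
      Integrable fun s => f (s, t) * Complex.exp (2 * π * Complex.I * (m * s)) := fun t m =>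
    ((hf.comp (by fun_prop : Continuous fun s : ℝ => (s, t))).mul (hw m)).integrable_of_hasCompactSupport
      (hcs t).mul_right
  have hfin : (Int.cast ⁻¹' Icc (-R - t) (R - t) : Set ℤ).Finite :=
    Int.isClosedEmbedding_coe_real.isCompact_preimage isCompact_Icc |>.finite_of_discrete
  have hl : ∀ s' (l : ℤ), l ∉ hfin.toFinset → f (s', t + l) = 0 := by
    intro s' l hl
    by_contra h0
    have := (hf0 _ _ h0).2
    exact hl (hfin.mem_toFinset.mpr ⟨by linarith [this.1], by linarith [this.2]⟩)
  have hinner : ∀ m : ℤ, ∑' l : ℤ,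
      ∫ s, f (s, t + l) * Complex.exp (2 * π * Complex.I * (m * s)) = 0 := by
    intro m
    have hcont : Continuous fun t => ∫ s, f (s, t) * Complex.exp (2 * π * Complex.I * (m * s)) := by
      have : (fun t => ∫ s, f (s, t) * Complex.exp (2 * π * Complex.I * (m * s))) =
          fun t => ∫ s in Icc (-R) R, f (s, t) * Complex.exp (2 * π * Complex.I * (m * s)) := by
        funext t
        refine (setIntegral_eq_integral_of_forall_compl_eq_zero fun s hs => ?_).symm
        rw [by_contra fun h0 => hs (hf0 s t h0).1, zero_mul]
      rw [this]
      refine continuous_parametric_integral_of_continuous (f := fun t s =>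
        f (s, t) * Complex.exp (2 * π * Complex.I * (m * s))) ?_ isCompact_Icc
      exact (hf.comp continuous_swap).mul ((hw m).comp continuous_snd)
    refine tsum_add_intCast_eq_zero hcont ?_ (fun n => ?_) t
    · refine HasCompactSupport.of_support_subset_isCompact (isCompact_Icc (a := -R) (b := R))
        fun t ht => by_contra fun h0 => ht ?_
      have : ∀ s, f (s, t) = 0 := fun s => by_contra fun h1 => h0 (hf0 s t h1).2
      simp [this]
    · rw [← h m n, Measure.volume_eq_prod, integral_prod_symm]
      · refine integral_congr_ae (ae_of_all _ fun t => ?_)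
        dsimp only
        rw [← integral_mul_const]
        refine integral_congr_ae (ae_of_all _ fun s => ?_)
        dsimp only [planeWave]
        rw [mul_assoc, ← Complex.exp_add, mul_add (2 * π * Complex.I)]
      · exact (hf.mul (contDiff_planeWave m n (r := 0)).continuous).integrable_of_hasCompactSupport
          hc.mul_right
  have hF : (fun s => ∑' l : ℤ, f (s, t + l)) = fun s => ∑ l ∈ hfin.toFinset, f (s, t + l) := by
    funext s
    exact tsum_eq_sum fun l h => hl s l h
  refine tsum_add_intCast_eq_zero (f := fun s => ∑' l : ℤ, f (s, t + l)) ?_ ?_ (fun m => ?_) s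
  · rw [hF]
    fun_prop
  · refine HasCompactSupport.of_support_subset_isCompact (isCompact_Icc (a := -R) (b := R))
      fun s hs => by_contra fun h0 => hs ?_
    have : ∀ t, f (s, t) = 0 := fun t => by_contra fun h1 => h0 (hf0 s t h1).1
    simp [this]
  · rw [← hinner m, tsum_eq_sum (s := hfin.toFinset) fun l h => by simp [hl _ l h],
      ← integral_finsetSum _ fun l _ => hint _ m]
    refine integral_congr_ae (ae_of_all _ fun s => ?_)
    dsimp only
    rw [congrFun hF s, Finset.sum_mul]

/-- The antisymmetrisation of a function over the symmetric group, dual to that in `lame`. -/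
noncomputable def antisymmetrize (f : ℝ × ℝ → ℂ) (q : ℝ × ℝ) : ℂ :=
  f q - f (q.2 - q.1, q.2) - f (q.1, q.1 - q.2) - f (-q.2, -q.1) + f (-q.2, q.1 - q.2)
    + f (q.2 - q.1, -q.1)

theorem HasCompactSupport.comp_matrixEquiv {f : ℝ × ℝ → ℂ} (hc : HasCompactSupport f)
    {a b c d : ℝ} (h : a * d - b * c ≠ 0) : HasCompactSupport fun q => f (matrixEquiv a b c d h q) :=
  hc.comp_homeomorph (matrixEquiv a b c d h).toHomeomorph

/-- A unimodular change of variables moves each group element from `f` to the character, with the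
same sign. -/
theorem integral_antisymmetrize_mul_planeWave {f : ℝ × ℝ → ℂ} (hf : Continuous f)
    (hc : HasCompactSupport f) (m n : ℤ) :
    ∫ q, antisymmetrize f q * planeWave m n q = ∫ q, f q * lame m n q := by
  have hi : ∀ m n : ℤ, Integrable fun q => f q * planeWave m n q := fun m n =>
    (hf.mul (contDiff_planeWave m n (r := 0)).continuous).integrable_of_hasCompactSupport hc.mul_right
  have key : ∀ (a b c d : ℝ) (h : a * d - b * c ≠ 0), |a * d - b * c| = 1 → ∀ m' n' : ℤ,
      (m' * a + n' * c = m ∧ m' * b + n' * d = n) →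
      Integrable (fun q : ℝ × ℝ => f (a * q.1 + b * q.2, c * q.1 + d * q.2) * planeWave m n q) ∧
      ∫ q : ℝ × ℝ, f (a * q.1 + b * q.2, c * q.1 + d * q.2) * planeWave m n q =
        ∫ q, f q * planeWave m' n' q := by
    intro a b c d h h1 m' n' hmn
    have hw : ∀ q : ℝ × ℝ, planeWave m n q =
        planeWave m' n' (a * q.1 + b * q.2, c * q.1 + d * q.2) := fun q =>
      planeWave_congr 0 (by
        rw [← hmn.1, ← hmn.2]
        push_cast
        ring)
    refine ⟨?_, ?_⟩
    · exact ((hf.comp (matrixEquiv a b c d h).continuous).mul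
        (contDiff_planeWave m n (r := 0)).continuous).integrable_of_hasCompactSupport
        (hc.comp_matrixEquiv h).mul_right
    · rw [← integral_comp_matrixEquiv h h1 fun q => f q * planeWave m' n' q]
      simp only [hw]
      rfl
  have hadd : ∀ {g h : ℝ × ℝ → ℂ} {x y : ℂ}, (Integrable g ∧ ∫ q, g q = x) →
      (Integrable h ∧ ∫ q, h q = y) →
      Integrable (fun q => g q + h q) ∧ ∫ q, (g q + h q) = x + y := fun hg hh =>
    ⟨hg.1.add hh.1, by rw [integral_add hg.1 hh.1, hg.2, hh.2]⟩
  have hsub : ∀ {g h : ℝ × ℝ → ℂ} {x y : ℂ}, (Integrable g ∧ ∫ q, g q = x) →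
      (Integrable h ∧ ∫ q, h q = y) →
      Integrable (fun q => g q - h q) ∧ ∫ q, (g q - h q) = x - y := fun hg hh =>
    ⟨hg.1.sub hh.1, by rw [integral_sub hg.1 hh.1, hg.2, hh.2]⟩
  have k0 := key 1 0 0 1 (by norm_num) (by norm_num) m n (by norm_num)
  have k1 := key (-1) 1 0 1 (by norm_num) (by norm_num) (-m) (m + n) (by push_cast; constructor <;> ring)
  have k2 := key 1 0 1 (-1) (by norm_num) (by norm_num) (m + n) (-n) (by push_cast; constructor <;> ring)
  have k3 := key 0 (-1) (-1) 0 (by norm_num) (by norm_num) (-n) (-m) (by push_cast; constructor <;> ring)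
  have k4 := key 0 (-1) 1 (-1) (by norm_num) (by norm_num) (-m - n) m
    (by push_cast; constructor <;> ring)
  have k5 := key (-1) 1 (-1) 0 (by norm_num) (by norm_num) n (-m - n)
    (by push_cast; constructor <;> ring)
  calc ∫ q, antisymmetrize f q * planeWave m n q
      = ∫ q : ℝ × ℝ, (f (1 * q.1 + 0 * q.2, 0 * q.1 + 1 * q.2) * planeWave m n q
        - f (-1 * q.1 + 1 * q.2, 0 * q.1 + 1 * q.2) * planeWave m n q
        - f (1 * q.1 + 0 * q.2, 1 * q.1 + -1 * q.2) * planeWave m n q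
        - f (0 * q.1 + -1 * q.2, -1 * q.1 + 0 * q.2) * planeWave m n q
        + f (0 * q.1 + -1 * q.2, 1 * q.1 + -1 * q.2) * planeWave m n q
        + f (-1 * q.1 + 1 * q.2, -1 * q.1 + 0 * q.2) * planeWave m n q) := by
        refine integral_congr_ae (ae_of_all _ fun q => ?_)
        simp only [antisymmetrize, one_mul, zero_mul, neg_mul, add_zero, zero_add]
        rw [show -q.1 + q.2 = q.2 - q.1 by ring, show q.1 + -q.2 = q.1 - q.2 by ring]
        ring
    _ = ∫ q, f q * lame m n q := by
        rw [(hadd (hadd (hsub (hsub (hsub k0 k1) k2) k3) k4) k5).2]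
        simp only [lame, mul_add, mul_sub]
        exact (hadd (hadd (hsub (hsub (hsub ⟨hi _ _, rfl⟩ ⟨hi _ _, rfl⟩) ⟨hi _ _, rfl⟩) ⟨hi _ _, rfl⟩)
          ⟨hi _ _, rfl⟩) ⟨hi _ _, rfl⟩).2.symm

theorem continuous_antisymmetrize {f : ℝ × ℝ → ℂ} (hf : Continuous f) :
    Continuous (antisymmetrize f) := by
  unfold antisymmetrize
  fun_prop

theorem hasCompactSupport_antisymmetrize {f : ℝ × ℝ → ℂ} (hc : HasCompactSupport f) :
    HasCompactSupport (antisymmetrize f) := by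
  have key : ∀ (a b c d : ℝ), a * d - b * c ≠ 0 →
      HasCompactSupport (fun q : ℝ × ℝ => f (a * q.1 + b * q.2, c * q.1 + d * q.2)) :=
    fun a b c d h => hc.comp_matrixEquiv h
  have h1 := key (-1) 1 0 1 (by norm_num)
  have h2 := key 1 0 1 (-1) (by norm_num)
  have h3 := key 0 (-1) (-1) 0 (by norm_num)
  have h4 := key 0 (-1) 1 (-1) (by norm_num)
  have h5 := key (-1) 1 (-1) 0 (by norm_num)
  convert! ((((hc.sub h1).sub h2).sub h3).add h4).add h5 using 1
  funext q
  simp [antisymmetrize, sub_eq_add_neg, add_comm]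

/-- In a function supported in a fundamental domain of the affine Weyl group, only the identity
contributes to the periodised antisymmetrisation. -/
theorem tsum_antisymmetrize {f : ℝ × ℝ → ℂ}
    (h0 : ∀ s t, f (s, t) ≠ 0 → 0 < 2 * s - t ∧ 0 < 2 * t - s ∧ s + t < 1) {s t : ℝ}
    (hs : 0 < 2 * s - t) (ht : 0 < 2 * t - s) (hst : s + t < 1) :
    ∑' k : ℤ, ∑' l : ℤ, antisymmetrize f (s + k, t + l) = f (s, t) := by
  -- On the triangle `2 s - t`, `2 t - s` and `s + t` lie strictly between `0` and `1`. If a moved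
  -- point also lies there, comparison gives strict integer inequalities for `k` and `l`, which
  -- force the identity or are contradictory.
  have hint : ∀ a b : ℤ, (a : ℝ) < b → a < b := fun a b h => by exact_mod_cast h
  have hid : ∀ k l : ℤ, f (s + k, t + l) ≠ 0 → k = 0 ∧ l = 0 := by
    intro k l h
    have := h0 _ _ h
    have g1 := hint (-1) (2 * k - l) (by push_cast; linarith)
    have g2 := hint (-1) (2 * l - k) (by push_cast; linarith)
    have g3 := hint (k + l) 1 (by push_cast; linarith)
    omega
  have hz : ∀ k l : ℤ, antisymmetrize f (s + k, t + l) = f (s + k, t + l) := by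
    intro k l
    have z1 : f (t + l - (s + k), t + l) = 0 := by
      by_contra h
      have := h0 _ _ h
      have g1 := hint 0 (l - 2 * k) (by push_cast; linarith)
      have g2 := hint (-1) (k + l) (by push_cast; linarith)
      have g3 := hint (2 * l - k) 1 (by push_cast; linarith)
      omega
    have z2 : f (s + k, s + k - (t + l)) = 0 := by
      by_contra h
      have := h0 _ _ h
      have g1 := hint (-1) (k + l) (by push_cast; linarith)
      have g2 := hint 0 (k - 2 * l) (by push_cast; linarith)
      have g3 := hint (2 * k - l) 1 (by push_cast; linarith)
      omega
    have z3 : f (-(t + l), -(s + k)) = 0 := by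
      by_contra h
      have := h0 _ _ h
      have g1 := hint 0 (k - 2 * l) (by push_cast; linarith)
      have g2 := hint 0 (l - 2 * k) (by push_cast; linarith)
      have g3 := hint (-(k + l)) 2 (by push_cast; linarith)
      omega
    have z4 : f (-(t + l), s + k - (t + l)) = 0 := by
      by_contra h
      have := h0 _ _ h
      have g1 := hint 0 (-k - l) (by push_cast; linarith)
      have g2 := hint (-1) (2 * k - l) (by push_cast; linarith)
      have g3 := hint (k - 2 * l) 2 (by push_cast; linarith)
      omega
    have z5 : f (t + l - (s + k), -(s + k)) = 0 := by
      by_contra h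
      have := h0 _ _ h
      have g1 := hint (-1) (2 * l - k) (by push_cast; linarith)
      have g2 := hint 0 (-k - l) (by push_cast; linarith)
      have g3 := hint (l - 2 * k) 2 (by push_cast; linarith)
      omega
    simp only [antisymmetrize, z1, z2, z3, z4, z5, sub_zero, add_zero]
  simp only [hz]
  rw [tsum_eq_single 0, tsum_eq_single 0]
  · simp
  · intro l hl
    by_contra h
    exact hl (hid _ _ h).2
  · intro k hk
    have : ∀ l : ℤ, f (s + k, t + l) = 0 := fun l => by_contra fun h => hk (hid _ _ h).1
    simp [this]

theorem hexForm_pos {m n : ℤ} (hm : 0 < m) (hn : 0 < n) : 0 < hexForm (m, n) := by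
  have hm' : (0 : ℝ) < m := by exact_mod_cast hm
  have hn' : (0 : ℝ) < n := by exact_mod_cast hn
  unfold hexForm
  positivity

theorem lameEigenvalue_pos {ℓ : ℝ} (hℓ : 0 < ℓ) {m n : ℤ} (hm : 0 < m) (hn : 0 < n) :
    0 < lameEigenvalue ℓ (m, n) := by
  have := hexForm_pos hm hn
  unfold lameEigenvalue
  positivity

/-- Every Lamé function vanishes or is, up to sign, one with positive indices. -/
theorem lame_eq_zero_or_exists (m n : ℤ) : lame m n = 0 ∨
    ∃ m' n' : ℤ, 0 < m' ∧ 0 < n' ∧ hexForm (m', n') = hexForm (m, n) ∧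
      (lame m n = lame m' n' ∨ lame m n = -lame m' n') := by
  rcases lt_trichotomy m 0 with hm | rfl | hm
  · rcases lt_trichotomy n 0 with hn | rfl | hn
    · refine Or.inr ⟨-n, -m, by omega, by omega, by simp only [hexForm]; push_cast; ring, Or.inr ?_⟩
      funext q
      simp only [lame, Pi.neg_apply]
      ring_nf
    · left
      funext q
      simp only [lame, Pi.zero_apply]
      ring_nf
    · rcases lt_trichotomy (m + n) 0 with h | h | h
      · refine Or.inr ⟨n, -m - n, by omega, by omega, by simp only [hexForm]; push_cast; ring,
          Or.inl ?_⟩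
        funext q
        simp only [lame]
        ring_nf
      · left
        obtain rfl : n = -m := by omega
        funext q
        simp only [lame, Pi.zero_apply]
        ring_nf
      · refine Or.inr ⟨-m, m + n, by omega, by omega, by simp only [hexForm]; push_cast; ring,
          Or.inr ?_⟩
        funext q
        simp only [lame, Pi.neg_apply]
        ring_nf
  · left
    funext q
    simp only [lame, Pi.zero_apply]
    ring_nf
  · rcases lt_trichotomy n 0 with hn | rfl | hn
    · rcases lt_trichotomy (m + n) 0 with h | h | h
      · refine Or.inr ⟨-m - n, m, by omega, by omega, by simp only [hexForm]; push_cast; ring,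
          Or.inl ?_⟩
        funext q
        simp only [lame]
        ring_nf
      · left
        obtain rfl : n = -m := by omega
        funext q
        simp only [lame, Pi.zero_apply]
        ring_nf
      · refine Or.inr ⟨m + n, -n, by omega, by omega, by simp only [hexForm]; push_cast; ring,
          Or.inr ?_⟩
        funext q
        simp only [lame, Pi.neg_apply]
        ring_nf
    · left
      funext q
      simp only [lame, Pi.zero_apply]
      ring_nf
    · exact Or.inr ⟨m, n, hm, hn, rfl, Or.inl rfl⟩

section Chart

variable {ℓ : ℝ} {Ω : Opens Plane} {A : Plane} {C : (ℝ × ℝ) ≃L[ℝ] Plane}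

/-- The Lamé functions are complete. -/
theorem IsTriangleChart.eq_zero_of_integral_mul_lame (hC : IsTriangleChart ℓ Ω A C)
    {u : Plane → ℂ} (hu : Continuous u) (hu0 : ∀ p ∉ Ω, u p = 0)
    (h : ∀ m n : ℤ, ∫ p in (Ω : Set Plane), u p * lame m n (C.symm (p - A)) = 0) : u = 0 := by
  let f : ℝ × ℝ → ℂ := fun q => u (A + C q)
  have hf : Continuous f := by fun_prop
  have hsupp : ∀ s t, f (s, t) ≠ 0 → 0 < 2 * s - t ∧ 0 < 2 * t - s ∧ s + t < 1 := fun s t hst =>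
    (hC.mem_iff s t).mp (by_contra fun hp => hst (hu0 _ hp))
  have hfc : HasCompactSupport f := by
    refine HasCompactSupport.of_support_subset_isCompact
      ((isCompact_Icc (a := (0 : ℝ)) (b := 1)).prod (isCompact_Icc (a := (0 : ℝ)) (b := 1)))
      fun q hq => ?_
    have := hsupp q.1 q.2 hq
    exact ⟨⟨by linarith, by linarith⟩, ⟨by linarith, by linarith⟩⟩
  obtain ⟨c, -, hc⟩ := exists_integral_comp_affineChart A C
  have hint : ∀ m n : ℤ, ∫ q, f q * lame m n q = 0 := by
    intro m n
    have h1 := hc fun p => u p * lame m n (C.symm (p - A))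
    rw [← setIntegral_eq_integral_of_forall_compl_eq_zero (s := (Ω : Set Plane))
      (f := fun p => u p * lame m n (C.symm (p - A)))
      fun p hp => by rw [hu0 p hp, zero_mul], h m n, mul_zero] at h1
    rw [← h1]
    refine integral_congr_ae (ae_of_all _ fun q => ?_)
    simp [f]
  funext p
  by_contra hp
  obtain ⟨⟨s, t⟩, rfl⟩ := (affineChart A C).surjective p
  have hst := hsupp s t hp
  have h1 := tsum_antisymmetrize hsupp hst.1 hst.2.1 hst.2.2
  rw [tsum_add_intCast_prod_eq_zero (continuous_antisymmetrize hf)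
    (hasCompactSupport_antisymmetrize hfc)
    (fun m n => by rw [integral_antisymmetrize_mul_planeWave hf hfc, hint])] at h1
  exact hp h1.symm

/-! ### Lamé modes as Dirichlet solutions, and their Fourier coefficients. -/

/-- The Lamé function, transported to the triangle `Ω` and extended by zero. -/
noncomputable def lameMode (Ω : Opens Plane) (A : Plane) (C : (ℝ × ℝ) ≃L[ℝ] Plane) (m n : ℤ) :
    Plane → ℂ :=
  (Ω : Set Plane).indicator fun p => lame m n (C.symm (p - A))

theorem IsTriangleChart.isDirichletSolution_lameMode (hC : IsTriangleChart ℓ Ω A C) (m n : ℤ) :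
    IsDirichletSolution Ω (lameEigenvalue ℓ (m, n)) (lameMode Ω A C m n) := by
  set φ : Plane → ℂ := fun p => lame m n (C.symm (p - A)) with hφ
  have hφc : ContDiff ℝ 2 φ := contDiff_comp_chart (contDiff_lame m n) A C
  have heq : ∀ p ∈ Ω, lameMode Ω A C m n =ᶠ[nhds p] φ := fun p hp => by
    filter_upwards [Ω.isOpen.mem_nhds hp] with x hx
    exact indicator_of_mem hx _
  obtain ⟨K, hK, hΩK⟩ := hC.exists_isCompact_superset
  refine ⟨?_, fun p hp => indicator_of_notMem hp _, fun p hp => hφc.contDiffAt.congr_of_eventuallyEq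
    (heq p hp), fun k hk => ?_, fun p hp => ?_⟩
  -- A frontier point satisfies the three closed inequalities but not all the strict ones, so it
  -- lies on a mirror, where the Lamé function vanishes.
  · refine continuous_indicator (fun p hp => ?_) hφc.continuous.continuousOn
    obtain ⟨⟨s, t⟩, rfl⟩ := (affineChart A C).surjective p
    rw [affineChart_apply] at hp ⊢
    have hclosed : IsClosed (affineChart A C '' {q | 0 ≤ 2 * q.1 - q.2 ∧ 0 ≤ 2 * q.2 - q.1 ∧
        q.1 + q.2 ≤ 1}) := by
      refine (affineChart A C).isClosedMap _ ?_
      have c1 : IsClosed {q : ℝ × ℝ | 0 ≤ 2 * q.1 - q.2} := isClosed_le (by fun_prop) (by fun_prop)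
      have c2 : IsClosed {q : ℝ × ℝ | 0 ≤ 2 * q.2 - q.1} := isClosed_le (by fun_prop) (by fun_prop)
      have c3 : IsClosed {q : ℝ × ℝ | q.1 + q.2 ≤ 1} := isClosed_le (by fun_prop) (by fun_prop)
      exact c1.inter (c2.inter c3)
    have hsub : (Ω : Set Plane) ⊆ affineChart A C '' {q | 0 ≤ 2 * q.1 - q.2 ∧ 0 ≤ 2 * q.2 - q.1 ∧
        q.1 + q.2 ≤ 1} := by
      intro p hp
      obtain ⟨⟨s, t⟩, rfl⟩ := (affineChart A C).surjective p
      have := (hC.mem_iff s t).mp hp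
      exact ⟨(s, t), ⟨this.1.le, this.2.1.le, this.2.2.le⟩, rfl⟩
    obtain ⟨q, hq, hqp⟩ := closure_minimal hsub hclosed (frontier_subset_closure hp)
    obtain rfl : q = (s, t) := (affineChart A C).injective hqp
    have hnot : A + C (s, t) ∉ Ω := fun h => by
      rw [Ω.isOpen.frontier_eq] at hp
      exact hp.2 h
    rw [hC.mem_iff] at hnot
    obtain ⟨h1, h2, h3⟩ := hq
    dsimp only at h1 h2 h3
    simp only [add_sub_cancel_left, ContinuousLinearEquiv.symm_apply_apply]
    rcases h1.eq_or_lt with h | h1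
    · exact lame_eq_zero_left m n (by dsimp only; linarith)
    rcases h2.eq_or_lt with h | h2
    · exact lame_eq_zero_right m n (by dsimp only; linarith)
    · exact lame_eq_zero_of_add_eq_one m n
        (le_antisymm h3 (not_lt.mp fun h => hnot ⟨h1, h2, h⟩))
  · have hk' : (k : WithTop ℕ∞) ≤ 2 := by exact_mod_cast hk
    have hcont : Continuous (iteratedFDeriv ℝ k φ) := hφc.continuous_iteratedFDeriv hk'
    have hfin : IsFiniteMeasure (volume.restrict (Ω : Set Plane)) :=
      isFiniteMeasure_restrict.mpr ((measure_mono hΩK).trans_lt hK.measure_lt_top).ne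
    obtain ⟨M, hM⟩ := hK.exists_bound_of_continuousOn hcont.continuousOn
    refine (MemLp.of_bound hcont.aestronglyMeasurable M
      (ae_restrict_of_forall_mem Ω.isOpen.measurableSet fun p hp => hM p (hΩK hp))).ae_eq
      (ae_restrict_of_forall_mem Ω.isOpen.measurableSet fun p hp => ?_)
    exact ((heq p hp).iteratedFDeriv ℝ k).eq_of_nhds.symm
  · rw [(InnerProductSpace.laplacian_congr_nhds (heq p hp)).eq_of_nhds, hC.laplacian_lame,
      (heq p hp).eq_of_nhds]
    ring

end Chart

theorem setIntegral_exp_int_mul (k : ℤ) :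
    ∫ x in Ioc (0 : ℝ) 1, Complex.exp (2 * π * Complex.I * (k * x)) = if k = 0 then 1 else 0 := by
  rw [← intervalIntegral.integral_of_le zero_le_one]
  split_ifs with hk
  · simp [hk]
  · have hc : 2 * π * Complex.I * k ≠ 0 :=
      mul_ne_zero Complex.two_pi_I_ne_zero (by exact_mod_cast hk)
    have h := integral_exp_mul_complex (a := 0) (b := 1) hc
    simp only [mul_assoc] at h ⊢
    rw [h]
    have h1 : Complex.exp (2 * (π * (Complex.I * (k * (1 : ℝ))))) = 1 :=
      Complex.exp_eq_one_iff.mpr ⟨k, by push_cast; ring⟩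
    rw [h1]
    simp

theorem setIntegral_planeWave (m n : ℤ) :
    ∫ q in Ioc (0 : ℝ) 1 ×ˢ Ioc (0 : ℝ) 1, planeWave m n q = if m = 0 ∧ n = 0 then 1 else 0 := by
  have h : ∀ q : ℝ × ℝ, planeWave m n q = Complex.exp (2 * π * Complex.I * (m * q.1)) *
      Complex.exp (2 * π * Complex.I * (n * q.2)) := fun q => by
    rw [planeWave, ← Complex.exp_add, mul_add (2 * π * Complex.I)]
  simp only [h]
  rw [Measure.volume_eq_prod, setIntegral_prod_mul (fun x : ℝ => Complex.exp (2 * π * Complex.I * (m * x)))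
    (fun x : ℝ => Complex.exp (2 * π * Complex.I * (n * x))), setIntegral_exp_int_mul,
    setIntegral_exp_int_mul]
  by_cases hm : m = 0 <;> by_cases hn : n = 0 <;> simp [hm, hn]

theorem planeWave_mul_neg (m n m' n' : ℤ) (q : ℝ × ℝ) :
    planeWave m n q * planeWave (-m') (-n') q = planeWave (m - m') (n - n') q := by
  rw [planeWave, planeWave, planeWave, ← Complex.exp_add]
  congr 1
  push_cast
  ring

theorem continuous_planeWave (m n : ℤ) : Continuous (planeWave m n) :=
  (contDiff_planeWave m n (r := 0)).continuous

theorem continuous_lame (m n : ℤ) : Continuous (lame m n) := (contDiff_lame m n (r := 0)).continuous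

theorem integrableOn_unitSquare {f : ℝ × ℝ → ℂ} (hf : Continuous f) :
    IntegrableOn f (Ioc (0 : ℝ) 1 ×ˢ Ioc (0 : ℝ) 1) :=
  (hf.continuousOn.integrableOn_compact (isCompact_Icc.prod isCompact_Icc)).mono_set
    (prod_mono Ioc_subset_Icc_self Ioc_subset_Icc_self)

/-- The Fourier coefficients with positive indices of the Lamé functions with positive indices. -/
theorem setIntegral_lame_mul_planeWave {m n m' n' : ℤ} (hm : 0 < m) (hn : 0 < n) (hm' : 0 < m')
    (hn' : 0 < n') : ∫ q in Ioc (0 : ℝ) 1 ×ˢ Ioc (0 : ℝ) 1, lame m n q * planeWave (-m') (-n') q =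
      if m = m' ∧ n = n' then 1 else 0 := by
  have hw : ∀ a b : ℤ, IntegrableOn (planeWave a b) (Ioc (0 : ℝ) 1 ×ˢ Ioc (0 : ℝ) 1) := fun a b =>
    integrableOn_unitSquare (continuous_planeWave a b)
  have hadd : ∀ {f g : ℝ × ℝ → ℂ} {x y : ℂ},
      (IntegrableOn f (Ioc (0 : ℝ) 1 ×ˢ Ioc (0 : ℝ) 1) ∧
        ∫ q in Ioc (0 : ℝ) 1 ×ˢ Ioc (0 : ℝ) 1, f q = x) →
      (IntegrableOn g (Ioc (0 : ℝ) 1 ×ˢ Ioc (0 : ℝ) 1) ∧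
        ∫ q in Ioc (0 : ℝ) 1 ×ˢ Ioc (0 : ℝ) 1, g q = y) →
      IntegrableOn (fun q => f q + g q) (Ioc (0 : ℝ) 1 ×ˢ Ioc (0 : ℝ) 1) ∧
        ∫ q in Ioc (0 : ℝ) 1 ×ˢ Ioc (0 : ℝ) 1, (f q + g q) = x + y := fun hf hg =>
    ⟨hf.1.add hg.1, by rw [integral_add hf.1 hg.1, hf.2, hg.2]⟩
  have hsub : ∀ {f g : ℝ × ℝ → ℂ} {x y : ℂ},
      (IntegrableOn f (Ioc (0 : ℝ) 1 ×ˢ Ioc (0 : ℝ) 1) ∧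
        ∫ q in Ioc (0 : ℝ) 1 ×ˢ Ioc (0 : ℝ) 1, f q = x) →
      (IntegrableOn g (Ioc (0 : ℝ) 1 ×ˢ Ioc (0 : ℝ) 1) ∧
        ∫ q in Ioc (0 : ℝ) 1 ×ˢ Ioc (0 : ℝ) 1, g q = y) →
      IntegrableOn (fun q => f q - g q) (Ioc (0 : ℝ) 1 ×ˢ Ioc (0 : ℝ) 1) ∧
        ∫ q in Ioc (0 : ℝ) 1 ×ˢ Ioc (0 : ℝ) 1, (f q - g q) = x - y := fun hf hg =>
    ⟨hf.1.sub hg.1, by rw [integral_sub hf.1 hg.1, hf.2, hg.2]⟩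
  have hz : ∀ a b : ℤ, ¬(a = m' ∧ b = n') →
      IntegrableOn (planeWave (a - m') (b - n')) (Ioc (0 : ℝ) 1 ×ˢ Ioc (0 : ℝ) 1) ∧
        ∫ q in Ioc (0 : ℝ) 1 ×ˢ Ioc (0 : ℝ) 1, planeWave (a - m') (b - n') q = 0 := fun a b h =>
    ⟨hw _ _, by rw [setIntegral_planeWave, if_neg (by omega)]⟩
  simp only [lame, add_mul, sub_mul, planeWave_mul_neg]
  -- Of the six frequencies only `(m, n)` has both entries positive; the other five are orthogonal
  -- to the character with index `(m', n')`.
  rw [(hadd (hadd (hsub (hsub (hsub ⟨hw (m - m') (n - n'), rfl⟩ (hz (-m) (m + n) (by omega)))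
    (hz (m + n) (-n) (by omega))) (hz (-n) (-m) (by omega))) (hz (-m - n) m (by omega)))
    (hz n (-m - n) (by omega))).2, setIntegral_planeWave]
  simp [sub_eq_zero]

theorem analyticOnNhd_lame (m n : ℤ) : AnalyticOnNhd ℝ (lame m n) univ :=
  contDiff_omega_iff_analyticOnNhd.mp (contDiff_lame m n)

/-! ### Multiplicities of the eigenvalues. -/

/-- The pairs of positive indices of the Lamé functions with eigenvalue `μ`. -/
abbrev LameIndex (ℓ μ : ℝ) : Type := {p : ℕ+ × ℕ+ // lameEigenvalue ℓ (p.1, p.2) = μ}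

theorem finite_lameIndex {ℓ : ℝ} (hℓ : 0 < ℓ) (μ : ℝ) : Finite (LameIndex ℓ μ) := by
  obtain ⟨N, hN⟩ := exists_nat_ge (μ / (16 * π ^ 2 / (9 * ℓ ^ 2)))
  have hc : 0 < 16 * π ^ 2 / (9 * ℓ ^ 2) := by positivity
  refine (((Set.finite_Iic (N + 1)).prod (Set.finite_Iic (N + 1))).preimage
    (f := fun p : ℕ+ × ℕ+ => ((p.1 : ℕ), (p.2 : ℕ))) ?_).subset ?_
  · rintro ⟨a, b⟩ - ⟨c, d⟩ - h
    simpa using h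
  · rintro ⟨m, n⟩ h
    have h' : lameEigenvalue ℓ (m, n) = μ := h
    have h1 : hexForm (m, n) ≤ N := by
      rw [← h', lameEigenvalue, mul_div_cancel_left₀ _ hc.ne'] at hN
      exact hN
    have hm : (1 : ℝ) ≤ m := by exact_mod_cast (one_le : 1 ≤ m)
    have hn : (1 : ℝ) ≤ n := by exact_mod_cast (one_le : 1 ≤ n)
    simp only [hexForm, Int.cast_natCast] at h1
    have h2 : (m : ℝ) ≤ N + 1 := by nlinarith
    have h3 : (n : ℝ) ≤ N + 1 := by nlinarith
    exact ⟨by exact_mod_cast h2, by exact_mod_cast h3⟩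

section Chart

variable {ℓ : ℝ} {Ω : Opens Plane} {A : Plane} {C : (ℝ × ℝ) ≃L[ℝ] Plane}

/-- A relation on the triangle extends to the whole plane by analyticity; its Fourier coefficients
over the unit square then isolate each scalar. -/
theorem IsTriangleChart.linearIndependent_lameMode (hC : IsTriangleChart ℓ Ω A C) :
    LinearIndependent ℂ fun p : ℕ+ × ℕ+ => lameMode Ω A C p.1 p.2 := by
  rw [linearIndependent_iff']
  intro S g hg i hi
  let F : ℝ × ℝ → ℂ := fun q => ∑ p ∈ S, g p * lame p.1 p.2 q
  have hFa : AnalyticOnNhd ℝ F univ := by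
    refine Finset.analyticOnNhd_fun_sum _ fun p _ => ?_
    exact analyticOnNhd_const.mul (analyticOnNhd_lame _ _)
  have hopen : IsOpen ((fun q : ℝ × ℝ => A + C q) ⁻¹' (Ω : Set Plane)) :=
    Ω.isOpen.preimage (by fun_prop)
  have hmem : ((1 / 3 : ℝ), (1 / 3 : ℝ)) ∈ (fun q : ℝ × ℝ => A + C q) ⁻¹' (Ω : Set Plane) :=
    (hC.mem_iff _ _).mpr (by norm_num)
  have hF : F = 0 := by
    refine hFa.eq_of_eventuallyEq (z₀ := (1 / 3, 1 / 3)) analyticOnNhd_const ?_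
    filter_upwards [hopen.mem_nhds hmem] with q hq
    have h1 := congrFun hg (A + C q)
    have hq' : A + C q ∈ (Ω : Set Plane) := hq
    rw [Finset.sum_apply] at h1
    simpa [lameMode, indicator_of_mem hq', F] using h1
  have h0 : ∫ q in Ioc (0 : ℝ) 1 ×ˢ Ioc (0 : ℝ) 1,
      F q * planeWave (-(i.1 : ℤ)) (-(i.2 : ℤ)) q = 0 := by simp [hF]
  have h1 : ∀ p : ℕ+ × ℕ+, ∫ q in Ioc (0 : ℝ) 1 ×ˢ Ioc (0 : ℝ) 1,
      g p * lame p.1 p.2 q * planeWave (-(i.1 : ℤ)) (-(i.2 : ℤ)) q = if p = i then g p else 0 := by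
    intro p
    simp only [mul_assoc]
    rw [integral_const_mul, setIntegral_lame_mul_planeWave (by exact_mod_cast p.1.pos)
      (by exact_mod_cast p.2.pos) (by exact_mod_cast i.1.pos) (by exact_mod_cast i.2.pos)]
    simp [Prod.ext_iff]
  simp only [F, Finset.sum_mul] at h0
  rw [integral_finsetSum (f := fun p : ℕ+ × ℕ+ => fun q =>
    g p * lame p.1 p.2 q * planeWave (-(i.1 : ℤ)) (-(i.2 : ℤ)) q) S fun p _ =>
    integrableOn_unitSquare ((continuous_const.mul (continuous_lame _ _)).mul
      (continuous_planeWave _ _))] at h0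
  simpa [h1, hi] using h0

theorem IsTriangleChart.integrableOn_mul_lame (hC : IsTriangleChart ℓ Ω A C) {u : Plane → ℂ}
    (hu : Continuous u) (m n : ℤ) :
    IntegrableOn (fun p => u p * lame m n (C.symm (p - A))) Ω := by
  obtain ⟨K, hK, hΩK⟩ := hC.exists_isCompact_superset
  refine ((hu.mul ?_).continuousOn.integrableOn_compact hK).mono_set hΩK
  exact (contDiff_comp_chart (contDiff_lame m n (r := 0)) A C).continuous

/-- The coefficients of a Dirichlet solution with respect to the Lamé functions. -/
noncomputable def lameCoefficients (hC : IsTriangleChart ℓ Ω A C) (μ : ℝ) :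
    dirichletEigenspace Ω μ →ₗ[ℂ] LameIndex ℓ μ → ℂ where
  toFun u i := ∫ p in (Ω : Set Plane), u.1 p * lame i.1.1 i.1.2 (C.symm (p - A))
  map_add' u v := by
    funext i
    rw [Pi.add_apply, ← integral_add (hC.integrableOn_mul_lame u.2.continuous _ _)
      (hC.integrableOn_mul_lame v.2.continuous _ _)]
    simp only [Submodule.coe_add, Pi.add_apply, add_mul]
  map_smul' c u := by
    funext i
    rw [Pi.smul_apply, smul_eq_mul, RingHom.id_apply, ← integral_const_mul]
    simp only [Submodule.coe_smul, Pi.smul_apply, smul_eq_mul, mul_assoc]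

/-- Coefficients at other eigenvalues vanish by Green's formula, and those with non-positive indices
reduce to positive ones up to sign; completeness finishes. -/
theorem injective_lameCoefficients (hC : IsTriangleChart ℓ Ω A C) (μ : ℝ) :
    Function.Injective (lameCoefficients hC μ) := by
  refine (injective_iff_map_eq_zero _).mpr fun u hu => ?_
  have hpos : ∀ m n : ℤ, 0 < m → 0 < n →
      ∫ p in (Ω : Set Plane), u.1 p * lame m n (C.symm (p - A)) = 0 := by
    intro m n hm hn
    by_cases hμ : lameEigenvalue ℓ (m, n) = μ
    · lift m to ℕ using hm.le
      lift n to ℕ using hn.le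
      exact congrFun hu ⟨(⟨m, by exact_mod_cast hm⟩, ⟨n, by exact_mod_cast hn⟩), hμ⟩
    · exact hC.integral_mul_lame_eq_zero u.2 hμ
  refine Subtype.ext (hC.eq_zero_of_integral_mul_lame u.2.continuous u.2.eq_zero fun m n => ?_)
  rcases lame_eq_zero_or_exists m n with h | ⟨m', n', hm, hn, -, h | h⟩
  · simp [h]
  · rw [h]
    exact hpos m' n' hm hn
  · simp only [h, Pi.neg_apply, mul_neg]
    rw [integral_neg, hpos m' n' hm hn, neg_zero]

theorem IsTriangleChart.finiteDimensional (hC : IsTriangleChart ℓ Ω A C) (hℓ : 0 < ℓ) (μ : ℝ) :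
    FiniteDimensional ℂ (dirichletEigenspace Ω μ) := by
  have := finite_lameIndex hℓ μ
  exact FiniteDimensional.of_injective _ (injective_lameCoefficients hC μ)

/-- Injectivity of the coefficient map bounds the dimension above, independence of the modes bounds
it below. -/
theorem IsTriangleChart.finrank_eq (hC : IsTriangleChart ℓ Ω A C) (hℓ : 0 < ℓ) (μ : ℝ) :
    Module.finrank ℂ (dirichletEigenspace Ω μ) = Nat.card (LameIndex ℓ μ) := by
  have := finite_lameIndex hℓ μ
  have := hC.finiteDimensional hℓ μ
  have := Fintype.ofFinite (LameIndex ℓ μ)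
  rw [Nat.card_eq_fintype_card]
  refine le_antisymm ?_ ?_
  · rw [← Module.finrank_fintype_fun_eq_card ℂ]
    exact LinearMap.finrank_le_finrank_of_injective (injective_lameCoefficients hC μ)
  · let v : LameIndex ℓ μ → dirichletEigenspace Ω μ := fun i =>
      ⟨lameMode Ω A C i.1.1 i.1.2, by
        have h := hC.isDirichletSolution_lameMode i.1.1 i.1.2
        rwa [i.2] at h⟩
    have hv : LinearIndependent ℂ v := by
      refine LinearIndependent.of_comp (dirichletEigenspace Ω μ).subtype ?_
      exact hC.linearIndependent_lameMode.comp (fun i : LameIndex ℓ μ => i.1) Subtype.val_injective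
    exact hv.fintype_card_le_finrank

theorem IsTriangleChart.mem_dirichletSpectrum_iff (hC : IsTriangleChart ℓ Ω A C) (hℓ : 0 < ℓ) (μ : ℝ) :
    μ ∈ dirichletSpectrum Ω ↔ Nonempty (LameIndex ℓ μ) := by
  have hfin := finite_lameIndex hℓ μ
  have := hC.finiteDimensional hℓ μ
  rw [dirichletSpectrum, Set.mem_ofPred_eq, ne_eq, ← Submodule.finrank_eq_zero, hC.finrank_eq hℓ,
    Nat.card_eq_zero, not_or, not_isEmpty_iff, not_infinite_iff_finite]
  exact and_iff_left hfin

end Chart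

/-! ### The spectral zeta function and the conclusion. -/

theorem lameEigenvalue_cpow_neg {ℓ : ℝ} (hℓ : 0 < ℓ) (s : ℂ) (p : ℤ × ℤ) :
    (lameEigenvalue ℓ p : ℂ) ^ (-s) =
      ((3 * ℓ / (4 * π) : ℝ) : ℂ) ^ (2 * s) * (1 / (hexForm p : ℂ) ^ s) := by
  have hh : 0 ≤ hexForm p := by
    unfold hexForm
    nlinarith [sq_nonneg ((p.1 : ℝ) + p.2), sq_nonneg (p.1 : ℝ), sq_nonneg (p.2 : ℝ)]
  have hc : 0 < (3 * ℓ / (4 * π)) ^ 2 := by positivity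
  have hl : lameEigenvalue ℓ p = ((3 * ℓ / (4 * π)) ^ 2)⁻¹ * hexForm p := by
    rw [lameEigenvalue]
    congr 1
    field_simp
    ring
  rw [cpow_two_mul_eq (by positivity), hl, Complex.ofReal_mul,
    Complex.mul_cpow_ofReal_nonneg (by positivity) hh, Complex.cpow_neg _ s, Complex.cpow_neg _ s,
    Complex.ofReal_inv, Complex.inv_cpow _ _ (by
      rw [Complex.arg_ofReal_of_nonneg hc.le]; exact pi_pos.ne), inv_inv, one_div]

theorem summable_lameEigenvalue_cpow {ℓ : ℝ} (hℓ : 0 < ℓ) {s : ℂ} (hs : 1 < s.re) :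
    Summable fun p : ℕ+ × ℕ+ => (lameEigenvalue ℓ (p.1, p.2) : ℂ) ^ (-s) := by
  simp only [lameEigenvalue_cpow_neg hℓ]
  refine Summable.mul_left _ ?_
  refine (summable_one_div_hexForm_cpow hs).comp_injective
    (i := fun p : ℕ+ × ℕ+ => (((p.1 : ℕ) : ℤ), ((p.2 : ℕ) : ℤ))) ?_
  rintro ⟨a, b⟩ ⟨c, d⟩ h
  simpa using h

/-- The spectral zeta function as a series over the indices of the Lamé functions. -/
theorem IsTriangleChart.hasSum_dirichletZetaTerm {ℓ : ℝ} {Ω : Opens Plane} {A : Plane}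
    {C : (ℝ × ℝ) ≃L[ℝ] Plane} (hC : IsTriangleChart ℓ Ω A C) (hℓ : 0 < ℓ) {s : ℂ} (hs : 1 < s.re) :
    HasSum (dirichletZetaTerm Ω s)
      (∑' p : ℕ+ × ℕ+, (lameEigenvalue ℓ (p.1, p.2) : ℂ) ^ (-s)) := by
  -- The fibre of this map over an eigenvalue has as many elements as its multiplicity, so summing
  -- over fibres turns the double series into the spectral one.
  let Φ : ℕ+ × ℕ+ → dirichletSpectrum Ω := fun p =>
    ⟨lameEigenvalue ℓ (p.1, p.2), (hC.mem_dirichletSpectrum_iff hℓ _).mpr ⟨⟨p, rfl⟩⟩⟩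
  have hsum := (Equiv.sigmaFiberEquiv Φ).summable_iff.mpr (summable_lameEigenvalue_cpow hℓ hs)
  have hterm : ∀ μ : dirichletSpectrum Ω, dirichletZetaTerm Ω s μ =
      ∑' x : {p // Φ p = μ}, (lameEigenvalue ℓ (x.1.1, x.1.2) : ℂ) ^ (-s) := by
    intro μ
    have hx : ∀ x : {p // Φ p = μ}, (lameEigenvalue ℓ (x.1.1, x.1.2) : ℂ) ^ (-s) =
        ((μ : ℝ) : ℂ) ^ (-s) := fun x => by
      rw [show lameEigenvalue ℓ (x.1.1, x.1.2) = μ from congrArg Subtype.val x.2]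
    have hcard : Nat.card {p // Φ p = μ} = Nat.card (LameIndex ℓ μ) :=
      Nat.card_congr (Equiv.subtypeEquivRight fun p => Subtype.ext_iff)
    simp only [hx]
    rw [tsum_const, hcard, dirichletZetaTerm, hC.finrank_eq hℓ, nsmul_eq_mul]
  rw [← (Equiv.sigmaFiberEquiv Φ).tsum_eq, funext hterm]
  exact hsum.hasSum.sigma fun μ => (hsum.sigma_factor μ).hasSum

theorem IsTriangleChart.dirichletZeta_eq {ℓ : ℝ} {Ω : Opens Plane} {A : Plane}
    {C : (ℝ × ℝ) ≃L[ℝ] Plane} (hC : IsTriangleChart ℓ Ω A C) (hℓ : 0 < ℓ) {s : ℂ} (hs : 1 < s.re) :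
    dirichletZeta Ω s = epsteinExpression ℓ s (epsteinTri s) := by
  rw [dirichletZeta, (hC.hasSum_dirichletZetaTerm hℓ hs).tsum_eq, epsteinTri_eq hs, epsteinExpression_eq hℓ,
    tsum_one_div_qTri_eq_sector hs]
  simp only [lameEigenvalue_cpow_neg hℓ]
  rw [tsum_mul_left]
  ring

theorem mainTheorem6 (ℓ : ℝ) (hℓ : 0 < ℓ) (Ω : Opens Plane) (hΩ : IsEquilateralTriangle ℓ Ω) :
    -- the eigenvalues are positive and have finite multiplicities
    ((∀ μ ∈ dirichletSpectrum Ω, 0 < μ) ∧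
      (∀ μ : ℝ, FiniteDimensional ℂ (dirichletEigenspace Ω μ))) ∧
    -- the integrals and the series in the first expression converge, the series exponentially fast
    ((∀ (s : ℂ) (n : ℕ+), IntegrableOn (besselIntegrand s n) (Ioi 0)) ∧
      (∀ s : ℂ, Summable fun n : ℕ+ => besselTerm s n) ∧
      (∀ (s : ℂ) (c : ℝ), c < π * √3 →
        (fun n : ℕ => besselTerm s n) =O[atTop] fun n : ℕ => Real.exp (-c * n))) ∧
    -- the two expressions where the spectral and the Epstein series converge absolutely
    (∀ s : ℂ, 1 < s.re →
      Summable (dirichletZetaTerm Ω s) ∧ Summable (epsteinTerm s) ∧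
      dirichletZeta Ω s = chowlaSelbergTri ℓ s ∧
      dirichletZeta Ω s = epsteinExpression ℓ s (epsteinTri s)) ∧
    -- the two expressions for the meromorphic continuations
    (∃ Z G : ℂ → ℂ,
      IsMeromorphicContinuation (dirichletZeta Ω) Z {1, 1 / 2} ∧
      IsMeromorphicContinuation epsteinTri G {1} ∧
      (∀ s : ℂ, s ≠ 1 → (∀ k : ℕ, s ≠ 1 / 2 - k) → Z s = chowlaSelbergTri ℓ s) ∧
      (∀ s : ℂ, s ≠ 1 → s ≠ 1 / 2 → Z s = epsteinExpression ℓ s (G s))) := by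
  obtain ⟨A, C, hC⟩ := hΩ.exists_chart hℓ
  refine ⟨⟨fun μ hμ => ?_, hC.finiteDimensional hℓ⟩,
    ⟨fun s n => besselIntegrand_integrableOn s n.pos, summable_besselTerm,
      fun s c hc => isBigO_besselTerm s hc⟩, fun s hs => ?_, ?_⟩
  · obtain ⟨⟨p, rfl⟩⟩ := (hC.mem_dirichletSpectrum_iff hℓ μ).mp hμ
    exact lameEigenvalue_pos hℓ (by exact_mod_cast p.1.pos) (by exact_mod_cast p.2.pos)
  · have h := hC.dirichletZeta_eq hℓ hs
    exact ⟨(hC.hasSum_dirichletZetaTerm hℓ hs).summable, summable_epsteinTerm hs,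
      h.trans (epsteinExpression_epsteinTri hℓ hs), h⟩
  -- The continuation of the spectral zeta function is defined by the second formula, which
  -- therefore holds by definition.
  · refine ⟨fun s => epsteinExpression ℓ s (epsteinContinuation s), epsteinContinuation, ?_,
      isMeromorphicContinuation_epstein, fun s => epsteinExpression_epsteinContinuation hℓ,
      fun s _ _ => rfl⟩
    obtain ⟨h1, h2, h3⟩ := isMeromorphicContinuation_epsteinExpression hℓ
    exact ⟨fun s hs => (h1 s hs).trans (hC.dirichletZeta_eq hℓ hs).symm, h2, h3⟩
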